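/- Let $(\mathbb X,\mathcal X)$ be a measurable space with countably generated $\sigma$-field and let $(Z_n)_{n\ge 0}$ be an irreducible Harris recurrent Markov chain on it with transition probability $P$: for some nonzero $\sigma$-finite measure $\varphi$, every $A\in\mathcal X$ with $\varphi(A)>0$ is visited infinitely often $\mathbf P_x$-almost surely, for every initial state $x$. Let $\pi$ be a $\sigma$-finite invariant measure of the chain with $\pi(\mathbb X)=\infty$. A set $S\in\mathcal X$ with $0<\pi(S)<\infty$ is called special if for every $A\in\mathcal X$ with $\pi(A)>0$ one has $\sup_{x\in\mathbb X}\mathbf E_x\sum_{n=1}^{\tau_A}1_S(Z_n)<\infty$, where $\tau_A=\inf\{n\ge 1: Z_n\in A\}$. For a special set $S$, a probability measure $\nu$ on $\mathbb X$ and real $t\geq 1$ put $$a_t(\nu,S)=\frac1{\pi(S)}\sum_{k=1}^{\lfloor t\rfloor}\int_{\mathbb X}P^k(x,S)\,\nu(dx).$$ Let $0\le\beta\le 1$ and suppose that the chain is $\beta$-regular: for some special set $S_0$ and $\nu_0=\pi(\,\cdot\cap S_0)/\pi(S_0)$, the function $t\mapsto a_t(\nu_0,S_0)$ is regularly varying at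 infinity with exponent $\beta$, i.e. $a_{ct}/a_t\to c^\beta$ as $t\to\infty$ for every $c>0$. Let $D=\bigcup_{i=1}^q\mathfrak a_i$, $1\le q<\infty$, where each $\mathfrak a_i\in\mathcal X$ is an atom (that is, $P(x,\cdot)=P(y,\cdot)$ for all $x,y\in\mathfrak a_i$) with $0<\pi(\mathfrak a_i)<\infty$. On the path space $E=\mathbb X^{\{0,1,2,\dots\}}$ with the product $\sigma$-field let $\mu(\cdot)=\int_{\mathbb X}\mathbf P_x(\cdot)\,\pi(dx)$, let $T$ be the left shift, $\tilde D=\{\mathbf x\in E: x_0\in D\}$ and $\tau_D(\mathbf x)=\inf\{n\ge 0: T^n\mathbf x\in\tilde D\}$. Then the wandering rate $\mu(\tau_D\le n)$ is finite for every $n$ and is a regularly varying sequence with exponent $1-\beta$. More precisely, for every special set $S$ and every probability measure $\nu$ on $\mathbb X$, with $a_n=a_n(\nu,S)$, $$\mu(\tau_D\le n)\sim\frac{1}{\Gamma(1+\beta)\,\Gamma(2-\beta)}\,\frac{n}{a_n}\qquad\text{as } n\to\infty .$$ -/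

import Mathlib

open MeasureTheory ProbabilityTheory Filter Topology Asymptotics
open scoped ENNReal NNReal

namespace HarrisChain

/-- `f` is regularly varying at infinity with exponent `ρ`. -/
def RegularlyVarying (f : ℝ → ℝ) (ρ : ℝ) : Prop :=
  (∀ᶠ t in atTop, 0 < f t) ∧
    ∀ c : ℝ, 0 < c → Tendsto (fun t => f (c * t) / f t) atTop (𝓝 (c ^ ρ))

/-- A sequence is regularly varying if its extension to real arguments, by rounding the argument
down to an integer, is. -/
def RegularlyVaryingSeq (u : ℕ → ℝ) (ρ : ℝ) : Prop :=
  RegularlyVarying (fun t => u ⌊t⌋₊) ρ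

section

variable {X : Type*} [MeasurableSpace X]

/-- The law `𝐏_x` on path space `ℕ → X` (product `σ`-algebra) of the Markov chain `(Z_n)_{n ≥ 0}`
with transition probability `P` and `Z_0 = x`; the chain is the coordinate process. -/
noncomputable def pathLaw (P : Kernel X X) [IsMarkovKernel P] (x : X) : Measure (ℕ → X) :=
  Kernel.traj (X := fun _ : ℕ => X)
    (fun n => P.comap (fun h => h ⟨n, Finset.mem_Iic.2 le_rfl⟩) (measurable_pi_apply _)) 0
    (fun _ => x)

/-- The chain with transition probability `P` is (irreducible and) Harris recurrent: for some
nonzero `σ`-finite measure `φ`, every set of positive `φ`-measure is visited infinitely often,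
almost surely, from every initial state. -/
def IsHarrisRecurrent (P : Kernel X X) [IsMarkovKernel P] : Prop :=
  ∃ φ : Measure X, SigmaFinite φ ∧ φ ≠ 0 ∧
    ∀ A : Set X, MeasurableSet A → 0 < φ A →
      ∀ x : X, ∀ᵐ ω ∂(pathLaw P x), ∃ᶠ n in atTop, ω n ∈ A

/-- Measurable sets of positive and finite `π`-measure. -/
def PosFinite (π : Measure X) (A : Set X) : Prop :=
  MeasurableSet A ∧ 0 < π A ∧ π A < ∞

/-- The first return time `inf {n ≥ 1 : Z_n ∈ A}` (infinite if there is no such `n`). -/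
noncomputable def returnTime (A : Set X) (ω : ℕ → X) : ℕ∞ :=
  sInf {m : ℕ∞ | ∃ n : ℕ, m = n ∧ 1 ≤ n ∧ ω n ∈ A}

/-- The number of visits to `S` at the times `1, …, τ_A`, where `τ_A` is the first return time
to `A`. -/
noncomputable def visitsUntil (S A : Set X) (ω : ℕ → X) : ℝ≥0∞ :=
  ∑' n : ℕ, {ω : ℕ → X | 1 ≤ n ∧ (n : ℕ∞) ≤ returnTime A ω ∧ ω n ∈ S}.indicator 1 ω

/-- Special sets (`D`-sets), of positive and finite `π`-measure: for every `A` with `π A > 0` the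
expected number of visits before the first return to `A` is bounded uniformly in the initial
state. -/
def IsSpecial (P : Kernel X X) [IsMarkovKernel P] (π : Measure X) (S : Set X) : Prop :=
  PosFinite π S ∧
    ∀ A : Set X, MeasurableSet A → 0 < π A →
      ∃ C : ℝ≥0, ∀ x : X, ∫⁻ ω, visitsUntil S A ω ∂(pathLaw P x) ≤ C

/-- `a_t(ν, A) = π(A)⁻¹ ∑_{1 ≤ k ≤ t} ∫ P^k(x, A) ν(dx)`. -/
noncomputable def meanVisits (P : Kernel X X) (π ν : Measure X) (A : Set X) (t : ℝ) : ℝ :=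
  (π A).toReal⁻¹ * ∑ k ∈ Finset.Icc 1 ⌊t⌋₊, (∫⁻ x, (P ^ k) x A ∂ν).toReal

/-- `β`-regularity: for some special set `S`, with initial distribution `π` conditioned on `S`,
the function `t ↦ a_t(π(· | S), S)` is regularly varying with exponent `β`. -/
def IsRegular (P : Kernel X X) [IsMarkovKernel P] (π : Measure X) (β : ℝ) : Prop :=
  ∃ S : Set X, IsSpecial P π S ∧ RegularlyVarying (meanVisits P π (π[|S]) S) β

/-- Atoms of the chain. -/
def IsAtom (P : Kernel X X) (a : Set X) : Prop :=
  ∀ x ∈ a, ∀ y ∈ a, P x = P y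

/-- Unions of finitely many (and at least one) atoms of positive and finite `π`-measure. -/
def IsFiniteUnionOfAtoms (P : Kernel X X) (π : Measure X) (D : Set X) : Prop :=
  ∃ (q : ℕ) (a : Fin q → Set X), 1 ≤ q ∧ (∀ i, PosFinite π (a i) ∧ IsAtom P (a i)) ∧
    D = ⋃ i, a i

/-- The measure `μ(A) = ∫ 𝐏_x(A) π(dx)` on path space. -/
noncomputable def pathMeasure (P : Kernel X X) [IsMarkovKernel P] (π : Measure X) :
    Measure (ℕ → X) :=
  π.bind (pathLaw P)

/-- The left shift on path space. -/
def pathShift (ω : ℕ → X) : ℕ → X := fun n => ω (n + 1)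

/-- The set of paths that start in `D`. -/
def startIn (D : Set X) : Set (ℕ → X) := {ω | ω 0 ∈ D}

/-- The entrance time `τ_D(ω) = inf {n ≥ 0 : T^n ω ∈ D̃}` on path space, where `T` is the shift
and `D̃` the set of paths that start in `D`. -/
noncomputable def entranceTime (D : Set X) (ω : ℕ → X) : ℕ∞ :=
  sInf {m : ℕ∞ | ∃ n : ℕ, m = n ∧ pathShift^[n] ω ∈ startIn D}

/-- The wandering rate `μ(τ_D ≤ n)`. -/
noncomputable def wanderingRate (P : Kernel X X) [IsMarkovKernel P] (π : Measure X) (D : Set X)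
    (n : ℕ) : ℝ≥0∞ :=
  pathMeasure P π {ω | entranceTime D ω ≤ (n : ℕ∞)}

/-- `x ↦ 𝐏_x` is measurable, so that the mixture `pathMeasure` is meaningful. -/
theorem measurable_pathLaw (P : Kernel X X) [IsMarkovKernel P] : Measurable (pathLaw P) :=
  (Kernel.measurable _).comp (measurable_pi_lambda _ fun _ => measurable_id)

end

end HarrisChain

/-! Fix one of the atoms, `a`, and a point `z` in it. Visits to `a` form a renewal process with
renewal probabilities u_k = P^k(z, a) and tails q_k = P_z(τ_a > k). Splitting at the last visit to
`a` up to time n gives ∑_{k ≤ n} u_{n-k} q_k = 1. Invariance of `π` identifies the wandering rate of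
`a` with π(a) ∑_{k ≤ n} q_k (`lintegral_hitBy`, `IsAtom.wanderingRate_eq`). So regularity speaks of
sums of u, the conclusion of sums of q, and the renewal equation ties the two.

Laplace transforms with weights e^{-k/t} turn the renewal equation into û(t) q̂(t) = 1/(1 -
e^{-1/t}) ~ t. With A(t) = ∑_{k ≤ t} u_k, the Abelian half of Karamata's theorem gives û(t) ~ Γ(1+β)
A(t). Hence q̂(t) ~ t / (Γ(1+β) A(t)), which is regularly varying with exponent 1-β, and the
Tauberian half gives ∑_{k ≤ t} q_k ~ q̂(t) / Γ(2-β). This is where the two Gamma factors arise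
(`tendsto_sum_mul_div_of_renewal`).

Two comparisons complete the argument. By `IsAtom.tendsto_meanVisits_div`, a_n(ν, S) / A(n) → 1/π(a)
for every special `S` and every `ν`. This carries regular variation from the given special set to A,
and at the end replaces A by a_n. By `tendsto_wanderingRate_div`, the wandering rates of `D` and `a`
are equivalent: `a` is reached from all of `D` within a bounded time with probability close to one,
the delay costs bounded mass, and π(X) = ∞ makes both rates diverge.

All this needs `a` to be hit almost surely from every state, although Harris recurrence is assumed
only for `φ`-positive sets. `alwaysHits_of_pos` proves it for sets of positive finite `π`-measure,
using `tendsto_lintegral_taboo`, which does not rely on uniqueness of `π`. Path probabilities are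
reduced throughout to iterates of the killed operator. -/

namespace HarrisChain

/-! ### The Markov property of the path law -/

section MarkovProperty

variable {X : Type*} [MeasurableSpace X] (P : Kernel X X) [IsMarkovKernel P]

instance (x : X) : IsProbabilityMeasure (pathLaw P x) := by
  unfold pathLaw; infer_instance

theorem measurable_pathShift : Measurable (pathShift (X := X)) :=
  measurable_pi_lambda _ fun n => measurable_pi_apply (n + 1)

/-- Given the history `h` up to time `n`, the factor `g` is constant and the next coordinate has law
`κ n h`. The path `ω₀` only fills in irrelevant values after time `n`. -/
theorem lintegral_traj_of_depends {n : ℕ}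
    (κ : (n : ℕ) → Kernel ((_ : Finset.Iic n) → X) X) [∀ n, IsMarkovKernel (κ n)]
    (h : (_ : Finset.Iic n) → X) (ω₀ : ℕ → X) {g : (ℕ → X) → ℝ≥0∞} (hg : Measurable g)
    (hdep : ∀ ω ω' : ℕ → X, (∀ i ≤ n, ω i = ω' i) → g ω = g ω')
    {f : X → ℝ≥0∞} (hf : Measurable f) :
    ∫⁻ ω, g ω * f (ω (n + 1)) ∂(Kernel.traj (X := fun _ => X) κ n h) =
      g (Function.updateFinset ω₀ (Finset.Iic n) h) * ∫⁻ y, f y ∂(κ n h) := by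
  have hm : Measurable fun ω : ℕ → X => f (ω (n + 1)) := hf.comp (measurable_pi_apply _)
  have hm2 : Measurable fun ω : ℕ → X => g ω * f (ω (n + 1)) := hg.mul hm
  rw [Kernel.lintegral_traj (X := fun _ => X) h hm2]
  have hpt : ∀ ω : ℕ → X, g (Function.updateFinset ω (Finset.Iic n) h) *
      f (Function.updateFinset ω (Finset.Iic n) h (n + 1)) =
      g (Function.updateFinset ω₀ (Finset.Iic n) h) * f (ω (n + 1)) := by
    intro ω
    congr 1
    · refine hdep _ _ fun i hi => ?_
      simp [Function.updateFinset, hi]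
    · simp [Function.updateFinset]
  simp_rw [hpt]
  rw [lintegral_const_mul _ hm]
  congr 1
  have := Kernel.map_traj_succ_self (X := fun _ => X) (κ := κ) (a := n)
  rw [← this, Kernel.map_apply _ (measurable_pi_apply _),
    lintegral_map hf (measurable_pi_apply _)]

/-- The Markov property at a fixed time, for the next step of the chain. -/
theorem lintegral_pathLaw_mul_next (x : X) (n : ℕ) {g : (ℕ → X) → ℝ≥0∞} (hg : Measurable g)
    (hdep : ∀ ω ω' : ℕ → X, (∀ i ≤ n, ω i = ω' i) → g ω = g ω')
    {f : X → ℝ≥0∞} (hf : Measurable f) :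
    ∫⁻ ω, g ω * f (ω (n + 1)) ∂(pathLaw P x) =
      ∫⁻ ω, g ω * ∫⁻ y, f y ∂(P (ω n)) ∂(pathLaw P x) := by
  set κ : (n : ℕ) → Kernel ((_ : Finset.Iic n) → X) X := fun n =>
    P.comap (fun h => h ⟨n, Finset.mem_Iic.2 le_rfl⟩) (measurable_pi_apply _) with hκ
  have hlaw : pathLaw P x = (Kernel.traj (X := fun _ => X) κ n ∘ₖ
      Kernel.partialTraj (X := fun _ => X) κ 0 n) (fun _ => x) := by
    rw [Kernel.traj_comp_partialTraj (X := fun _ => X) (Nat.zero_le n)]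
    rfl
  have hPf : Measurable fun y => ∫⁻ z, f z ∂(P y) := hf.lintegral_kernel
  have hm : Measurable fun ω : ℕ → X => f (ω (n + 1)) := hf.comp (measurable_pi_apply _)
  have hm' : Measurable fun ω : ℕ → X => ∫⁻ z, f z ∂(P (ω n)) :=
    hPf.comp (measurable_pi_apply _)
  have hm2 : Measurable fun ω : ℕ → X => g ω * f (ω (n + 1)) := hg.mul hm
  have hm2' : Measurable fun ω : ℕ → X => g ω * ∫⁻ z, f z ∂(P (ω n)) := hg.mul hm'
  rw [hlaw, Kernel.lintegral_comp _ _ _ hm2, Kernel.lintegral_comp _ _ _ hm2']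
  refine lintegral_congr fun h => ?_
  have h1 := lintegral_traj_of_depends κ h (fun _ => x) hg hdep hf
  -- The other side is a function of the history alone; taking `f = 1` evaluates its integral.
  have h2 := lintegral_traj_of_depends κ h (fun _ => x) hm2'
    (fun ω ω' hω => by rw [hdep ω ω' hω, hω n le_rfl])
    (f := fun _ => 1) measurable_const
  rw [h1]
  simp only [mul_one, lintegral_one, measure_univ] at h2
  rw [h2]
  simp [hκ, Function.updateFinset, Kernel.comap_apply]

theorem lintegral_pathLaw_zero (x : X) {f : X → ℝ≥0∞} (hf : Measurable f) :
    ∫⁻ ω, f (ω 0) ∂(pathLaw P x) = f x := by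
  unfold pathLaw
  have hm : Measurable fun ω : ℕ → X => f (ω 0) := hf.comp (measurable_pi_apply 0)
  rw [Kernel.lintegral_traj (X := fun _ => X) _ hm]
  simp [Function.updateFinset]

/-- The fixed-time Markov property absorbs the last factor into the preceding one and so shortens
the product from its far end (`key`). Doing this on both sides reduces the splitting at the first
step to shorter products. -/
theorem lintegral_pathLaw_prod_succ (n : ℕ) : ∀ (f : ℕ → X → ℝ≥0∞), (∀ i, Measurable (f i)) →
    ∀ x, ∫⁻ ω, ∏ i ∈ Finset.range (n + 2), f i (ω i) ∂(pathLaw P x) =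
      f 0 x * ∫⁻ y, ∫⁻ ω, ∏ i ∈ Finset.range (n + 1), f (i + 1) (ω i) ∂(pathLaw P y) ∂(P x) := by
  induction n with
  | zero =>
    intro f hf x
    have := lintegral_pathLaw_mul_next P x 0 (g := fun ω => f 0 (ω 0))
      ((hf 0).comp (measurable_pi_apply 0)) (fun ω ω' h => by rw [h 0 le_rfl]) (hf 1)
    simp only [Finset.prod_range_succ, Finset.range_zero, Finset.prod_empty, one_mul, zero_add]
      at this ⊢
    rw [this, lintegral_pathLaw_zero P x
      (f := fun z => f 0 z * ∫⁻ y, f 1 y ∂(P z)) ((hf 0).mul (hf 1).lintegral_kernel)]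
    congr 1
    exact lintegral_congr fun y => (lintegral_pathLaw_zero P y (hf 1)).symm
  | succ n ih =>
    intro f hf x
    have key : ∀ (f : ℕ → X → ℝ≥0∞) (_ : ∀ i, Measurable (f i)) (x : X) (n : ℕ),
        ∫⁻ ω, ∏ i ∈ Finset.range (n + 2), f i (ω i) ∂(pathLaw P x) =
        ∫⁻ ω, ∏ i ∈ Finset.range (n + 1),
          (if i = n then fun z => f n z * ∫⁻ y, f (n + 1) y ∂(P z) else f i) (ω i)
            ∂(pathLaw P x) := by
      intro f hf x n
      have hg : Measurable fun ω : ℕ → X => ∏ i ∈ Finset.range (n + 1), f i (ω i) :=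
        Finset.measurable_fun_prod _ fun i _ => (hf i).comp (measurable_pi_apply i)
      have := lintegral_pathLaw_mul_next P x n hg (fun ω ω' h => Finset.prod_congr rfl fun i hi => by
        rw [h i (by simpa [Nat.lt_succ_iff] using hi)]) (hf (n + 1))
      simp only [Finset.prod_range_succ _ (n + 1)]
      rw [this]
      refine lintegral_congr fun ω => ?_
      rw [Finset.prod_range_succ, Finset.prod_range_succ, mul_assoc]
      congr 1
      · refine Finset.prod_congr rfl fun i hi => ?_
        rw [if_neg (Finset.mem_range.1 hi).ne]
      · simp
    rw [key f hf x (n + 1)]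
    rw [ih (fun i => if i = n + 1 then fun z => f (n + 1) z * ∫⁻ y, f (n + 2) y ∂(P z) else f i)
      (fun i => by
        split_ifs
        · exact (hf _).mul (hf _).lintegral_kernel
        · exact hf i) x]
    congr 1
    · refine lintegral_congr fun y => ?_
      rw [key (fun i => f (i + 1)) (fun i => hf _) y n]
      simp

/-- Concatenation of an initial state and a path. -/
def pathCons (x : X) (ω : ℕ → X) : ℕ → X := fun n => Nat.casesOn n x ω

theorem measurable_pathCons (x : X) : Measurable (pathCons x) :=
  measurable_pi_lambda _ fun n => by
    cases n with
    | zero => exact measurable_const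
    | succ n => exact measurable_pi_apply n

/-- Both sides are probability measures, so it suffices to compare them on the π-system of
finite-dimensional rectangles, where the identity is the product formula just proved. -/
theorem pathLaw_eq_map_cons (x : X) :
    pathLaw P x = ((P x).bind (pathLaw P)).map (pathCons x) := by
  have hprob : IsProbabilityMeasure ((P x).bind (pathLaw P)) :=
    ⟨by simp [Measure.bind_apply .univ (measurable_pathLaw P).aemeasurable]⟩
  have hprob' : IsProbabilityMeasure (((P x).bind (pathLaw P)).map (pathCons x)) :=
    Measure.isProbabilityMeasure_map (measurable_pathCons x).aemeasurable
  refine ext_of_generate_finite _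
    (generateFrom_squareCylinders (α := fun _ : ℕ => X)).symm
    (isPiSystem_squareCylinders (fun _ => MeasurableSpace.isPiSystem_measurableSet)
      (fun _ => .univ)) ?_ (by simp)
  rintro _ ⟨s, t, ht, rfl⟩
  have ht' : ∀ i, MeasurableSet (t i) := fun i => ht i (Set.mem_univ i)
  have hst : MeasurableSet ((s : Set ℕ).pi t) :=
    MeasurableSet.pi s.countable_toSet fun i _ => ht' i
  obtain ⟨n, hn⟩ : ∃ n, s ⊆ Finset.range (n + 2) :=
    ⟨s.sup id, fun i hi => by
      have := Finset.le_sup (f := id) hi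
      simp only [id, Finset.mem_range] at this ⊢; omega⟩
  classical
  set f : ℕ → X → ℝ≥0∞ := fun i => if i ∈ s then (t i).indicator 1 else 1 with hfdef
  have hf : ∀ i, Measurable (f i) := fun i => by
    simp only [hfdef]; split_ifs
    · exact measurable_one.indicator (ht' i)
    · exact measurable_one
  have hind : ∀ ω : ℕ → X, ∏ i ∈ Finset.range (n + 2), f i (ω i) =
      ((s : Set ℕ).pi t).indicator 1 ω := by
    intro ω
    by_cases hω : ω ∈ (s : Set ℕ).pi t
    · rw [Set.indicator_of_mem hω]
      refine Finset.prod_eq_one fun i _ => ?_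
      simp only [hfdef]; split_ifs with his
      · simp [Set.indicator_of_mem (hω i his)]
      · rfl
    · rw [Set.indicator_of_notMem hω]
      simp only [Set.mem_pi, Finset.mem_coe, not_forall] at hω
      obtain ⟨i, his, hi⟩ := hω
      refine Finset.prod_eq_zero (hn his) ?_
      simp [hfdef, his, hi]
  have h := lintegral_pathLaw_prod_succ P n f hf x
  have hcons : ∀ ω : ℕ → X, f 0 x * ∏ i ∈ Finset.range (n + 1), f (i + 1) (ω i) =
      ((s : Set ℕ).pi t).indicator 1 (pathCons x ω) := by
    intro ω
    rw [← hind, Finset.prod_range_succ' _ (n + 1), mul_comm]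
    rfl
  have hmp : Measurable fun ω : ℕ → X => ∏ i ∈ Finset.range (n + 1), f (i + 1) (ω i) :=
    Finset.measurable_fun_prod _ fun i _ => (hf _).comp (measurable_pi_apply i)
  simp_rw [hind] at h
  rw [lintegral_indicator_one hst] at h
  rw [h, ← lintegral_indicator_one hst, lintegral_map (measurable_one.indicator hst)
    (measurable_pathCons x)]
  simp_rw [← hcons]
  rw [lintegral_const_mul _ hmp,
    Measure.lintegral_bind (measurable_pathLaw P).aemeasurable hmp.aemeasurable]

/-- The one-step Markov property on path space. -/
theorem lintegral_pathLaw_mul_shift (x : X) {f : X → ℝ≥0∞} (hf : Measurable f)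
    {G : (ℕ → X) → ℝ≥0∞} (hG : Measurable G) :
    ∫⁻ ω, f (ω 0) * G (pathShift ω) ∂(pathLaw P x) =
      f x * ∫⁻ y, ∫⁻ ω, G ω ∂(pathLaw P y) ∂(P x) := by
  have hm : Measurable fun ω : ℕ → X => f (ω 0) * G (pathShift ω) :=
    (hf.comp (measurable_pi_apply 0)).mul (hG.comp measurable_pathShift)
  rw [pathLaw_eq_map_cons, lintegral_map hm (measurable_pathCons x)]
  change ∫⁻ ω, f x * G ω ∂_ = _
  rw [lintegral_const_mul _ hG,
    Measure.lintegral_bind (measurable_pathLaw P).aemeasurable hG.aemeasurable]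

end MarkovProperty

/-! ### The killed chain and invariant measures -/

section Killed

variable {X : Type*} [MeasurableSpace X] (P : Kernel X X)

/-- One step of the chain killed on entering `a`. -/
noncomputable def killedStep (a : Set X) (h : X → ℝ≥0∞) : X → ℝ≥0∞ :=
  fun x => ∫⁻ y in aᶜ, h y ∂(P x)

/-- `k` steps of the chain killed on entering `a`. -/
noncomputable def killed (a : Set X) (k : ℕ) (h : X → ℝ≥0∞) : X → ℝ≥0∞ :=
  (killedStep P a)^[k] h

/-- The probability that the chain avoids `a` at the times `1, …, k`. -/
noncomputable def survival (a : Set X) (k : ℕ) : X → ℝ≥0∞ := killed P a k 1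

/-- The probability that the chain avoids `a` at the times `1, …, k` and is in `S` at time
`k + 1`. -/
noncomputable def taboo (a S : Set X) (k : ℕ) : X → ℝ≥0∞ := killed P a k fun x => P x S

variable {P} {a S : Set X}

theorem killed_zero (h : X → ℝ≥0∞) : killed P a 0 h = h := rfl

theorem killed_succ (k : ℕ) (h : X → ℝ≥0∞) :
    killed P a (k + 1) h = killed P a k (killedStep P a h) :=
  Function.iterate_succ_apply _ _ _

theorem killed_succ' (k : ℕ) (h : X → ℝ≥0∞) :
    killed P a (k + 1) h = killedStep P a (killed P a k h) :=
  Function.iterate_succ_apply' _ _ _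

theorem killed_add' (m k : ℕ) (h : X → ℝ≥0∞) :
    killed P a (m + k) h = killed P a m (killed P a k h) :=
  Function.iterate_add_apply _ _ _ _

theorem measurable_killedStep (ha : MeasurableSet a) {h : X → ℝ≥0∞} (hh : Measurable h) :
    Measurable (killedStep P a h) := by
  unfold killedStep
  simp_rw [← lintegral_indicator ha.compl]
  exact (hh.indicator ha.compl).lintegral_kernel

theorem measurable_killed (ha : MeasurableSet a) (k : ℕ) :
    ∀ {h : X → ℝ≥0∞}, Measurable h → Measurable (killed P a k h) := by
  induction k with
  | zero => exact fun hh => hh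
  | succ k ih => exact fun hh => by rw [killed_succ']; exact measurable_killedStep ha (ih hh)

theorem measurable_survival (ha : MeasurableSet a) (k : ℕ) : Measurable (survival P a k) :=
  measurable_killed ha k measurable_one

theorem measurable_taboo (ha : MeasurableSet a) (hS : MeasurableSet S) (k : ℕ) :
    Measurable (taboo P a S k) :=
  measurable_killed ha k (P.measurable_coe hS)

theorem killedStep_mono {h h' : X → ℝ≥0∞} (hle : h ≤ h') :
    killedStep P a h ≤ killedStep P a h' := fun _ => lintegral_mono hle

theorem killed_mono (k : ℕ) {h h' : X → ℝ≥0∞} (hle : h ≤ h') :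
    killed P a k h ≤ killed P a k h' := by
  induction k with
  | zero => exact hle
  | succ k ih => rw [killed_succ', killed_succ']; exact killedStep_mono ih

theorem killed_add (ha : MeasurableSet a) (k : ℕ) {h h' : X → ℝ≥0∞} (hh : Measurable h) :
    killed P a k (h + h') = killed P a k h + killed P a k h' := by
  induction k with
  | zero => rfl
  | succ k ih =>
    rw [killed_succ', killed_succ', killed_succ', ih]
    ext x
    exact lintegral_add_left (measurable_killed ha k hh) _

theorem killed_const_mul (ha : MeasurableSet a) (k : ℕ) {h : X → ℝ≥0∞} (hh : Measurable h)
    (c : ℝ≥0∞) : killed P a k (fun x => c * h x) = fun x => c * killed P a k h x := by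
  induction k with
  | zero => rfl
  | succ k ih =>
    rw [killed_succ', killed_succ', ih]
    ext x
    exact lintegral_const_mul _ (measurable_killed ha k hh)

theorem killed_sum (ha : MeasurableSet a) (k : ℕ) {h : ℕ → X → ℝ≥0∞}
    (hh : ∀ i, Measurable (h i)) (s : Finset ℕ) :
    killed P a k (fun x => ∑ i ∈ s, h i x) = fun x => ∑ i ∈ s, killed P a k (h i) x := by
  induction k with
  | zero => rfl
  | succ k ih =>
    rw [killed_succ', ih]
    simp_rw [killed_succ']
    ext x
    exact lintegral_finsetSum _ fun i _ => measurable_killed ha k (hh i)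

theorem lintegral_eq_killedStep_add (ha : MeasurableSet a) (h : X → ℝ≥0∞) (x : X) :
    ∫⁻ y, h y ∂(P x) = killedStep P a h x + ∫⁻ y in a, h y ∂(P x) := by
  rw [add_comm]; exact (lintegral_add_compl _ ha).symm

theorem killedStep_le (h : X → ℝ≥0∞) (x : X) : killedStep P a h x ≤ ∫⁻ y, h y ∂(P x) :=
  setLIntegral_le_lintegral _ _

section Markov

variable [IsMarkovKernel P]

theorem survival_eq_add (ha : MeasurableSet a) (k : ℕ) (x : X) :
    survival P a k x = survival P a (k + 1) x + taboo P a a k x := by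
  have h1 : (1 : X → ℝ≥0∞) = killedStep P a 1 + fun x => P x a := by
    ext x
    have := lintegral_eq_killedStep_add (P := P) ha 1 x
    simpa using this
  unfold survival taboo
  conv_lhs => rw [h1]
  rw [killed_add ha k (measurable_killedStep ha measurable_one), killed_succ]
  rfl

theorem survival_succ_le (k : ℕ) (x : X) : survival P a (k + 1) x ≤ survival P a k x := by
  unfold survival
  rw [killed_succ]
  refine killed_mono k ?_ x
  intro y
  exact (killedStep_le _ _).trans (by simp)

theorem survival_antitone (x : X) : Antitone fun k => survival P a k x :=
  antitone_nat_of_succ_le fun k => survival_succ_le k x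

theorem survival_le_one (k : ℕ) (x : X) : survival P a k x ≤ 1 :=
  survival_antitone x (Nat.zero_le k)

theorem taboo_le_one (k : ℕ) (x : X) : taboo P a S k x ≤ 1 :=
  (killed_mono k (fun _ => prob_le_one) x).trans (survival_le_one (P := P) (a := a) k x)

/-- Partition by the first positive time in `a`: `taboo P a a j` is the probability that this time
is `j + 1`. -/
theorem survival_add_sum_taboo (ha : MeasurableSet a) (k : ℕ) (x : X) :
    survival P a k x + ∑ j ∈ Finset.range k, taboo P a a j x = 1 := by
  induction k with
  | zero => simp [survival, killed]
  | succ k ih =>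
    rw [Finset.sum_range_succ, ← ih, survival_eq_add ha k]
    ring

/-- The chain is in `a` at some positive time, almost surely, from every initial state. -/
def AlwaysHits (P : Kernel X X) (a : Set X) : Prop :=
  ∀ x, Tendsto (fun k => survival P a k x) atTop (𝓝 0)

end Markov

section Invariant

variable {π : Measure X}

theorem lintegral_lintegral_of_invariant (hinv : P.Invariant π) {h : X → ℝ≥0∞}
    (hh : Measurable h) : ∫⁻ x, ∫⁻ y, h y ∂(P x) ∂π = ∫⁻ x, h x ∂π := by
  conv_rhs => rw [← hinv.def]
  rw [Measure.lintegral_bind P.measurable.aemeasurable hh.aemeasurable]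

theorem lintegral_killedStep (hinv : P.Invariant π) (ha : MeasurableSet a) {h : X → ℝ≥0∞}
    (hh : Measurable h) : ∫⁻ x, killedStep P a h x ∂π = ∫⁻ x in aᶜ, h x ∂π := by
  unfold killedStep
  simp_rw [← lintegral_indicator ha.compl]
  exact lintegral_lintegral_of_invariant hinv (hh.indicator ha.compl)

theorem lintegral_killed_le (hinv : P.Invariant π) (ha : MeasurableSet a) (k : ℕ)
    {h : X → ℝ≥0∞} (hh : Measurable h) : ∫⁻ x, killed P a k h x ∂π ≤ ∫⁻ x, h x ∂π := by
  induction k with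
  | zero => exact le_rfl
  | succ k ih =>
    rw [killed_succ', lintegral_killedStep hinv ha (measurable_killed ha k hh)]
    exact (setLIntegral_le_lintegral _ _).trans ih

/-- By invariance, one more killed step loses exactly the mass located in `a`. -/
theorem lintegral_killed_eq_add (hinv : P.Invariant π) (ha : MeasurableSet a) (k : ℕ)
    {h : X → ℝ≥0∞} (hh : Measurable h) :
    ∫⁻ x, killed P a k h x ∂π =
      ∫⁻ x, killed P a (k + 1) h x ∂π + ∫⁻ x in a, killed P a k h x ∂π := by
  rw [killed_succ', lintegral_killedStep hinv ha (measurable_killed ha k hh), add_comm]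
  exact (lintegral_add_compl _ ha).symm

theorem lintegral_taboo_zero (hinv : P.Invariant π) (hS : MeasurableSet S) :
    ∫⁻ x, taboo P a S 0 x ∂π = π S := by
  have := lintegral_lintegral_of_invariant hinv (measurable_one.indicator hS)
  simpa [taboo, killed_zero, lintegral_indicator_one hS] using this

/-- Decomposition of `π S` according to the last visit to `a`. -/
theorem lintegral_taboo_add_sum (hinv : P.Invariant π) (ha : MeasurableSet a)
    (hS : MeasurableSet S) (n : ℕ) :
    ∫⁻ x, taboo P a S n x ∂π + ∑ k ∈ Finset.range n, ∫⁻ x in a, taboo P a S k x ∂π = π S := by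
  induction n with
  | zero => simp [lintegral_taboo_zero hinv hS]
  | succ n ih =>
    rw [Finset.sum_range_succ, ← ih]
    conv_rhs => rw [taboo, lintegral_killed_eq_add hinv ha n (P.measurable_coe hS)]
    rw [taboo, taboo]
    ring

variable [IsMarkovKernel P]

/-- A duality under time reversal: entering `a` after `k` steps outside it has the same stationary
mass as leaving `a` for `k` steps. Both sides start at `π a` and lose the same finite amount at each
step. -/
theorem lintegral_taboo_self (hinv : P.Invariant π) (ha : MeasurableSet a) (hπa : π a ≠ ∞)
    (k : ℕ) : ∫⁻ x, taboo P a a k x ∂π = ∫⁻ x in a, survival P a k x ∂π := by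
  induction k with
  | zero => rw [lintegral_taboo_zero hinv ha]; simp [survival, killed]
  | succ k ih =>
    have h1 := lintegral_killed_eq_add hinv ha k (P.measurable_coe ha)
    change ∫⁻ x, taboo P a a k x ∂π =
      ∫⁻ x, taboo P a a (k + 1) x ∂π + ∫⁻ x in a, taboo P a a k x ∂π at h1
    have h2 : ∫⁻ x in a, survival P a k x ∂π =
        ∫⁻ x in a, survival P a (k + 1) x ∂π + ∫⁻ x in a, taboo P a a k x ∂π := by
      rw [← lintegral_add_left (measurable_survival ha _)]
      exact lintegral_congr fun x => survival_eq_add ha k x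
    have hfin : ∫⁻ x in a, taboo P a a k x ∂π ≠ ∞ := by
      refine ne_top_of_le_ne_top hπa ?_
      calc _ ≤ ∫⁻ x in a, 1 ∂π := lintegral_mono fun x => taboo_le_one k x
        _ = π a := by simp
    rw [h1, h2] at ih
    exact (ENNReal.add_left_inj hfin).1 ih

theorem tendsto_lintegral_survival (ha : MeasurableSet a) (hπa : π a ≠ ∞)
    (hhit : AlwaysHits P a) :
    Tendsto (fun k => ∫⁻ x in a, survival P a k x ∂π) atTop (𝓝 0) := by
  have := tendsto_lintegral_of_dominated_convergence (μ := π.restrict a) (f := fun _ => 0)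
    (F := fun k => survival P a k) (fun _ => 1)
    (fun k => measurable_survival ha k) (fun k => ae_of_all _ fun x => survival_le_one k x)
    (by simpa using hπa) (ae_of_all _ fun x => hhit x)
  simpa using this

/-- Split by the position at time `n + 1`. Outside `a`, the first entrance comes `k + 1` steps
later. Inside `a`, time `n + 1` is itself the first entrance, and the remaining factor is at most
one. -/
theorem killed_lintegral_taboo_le (ha : MeasurableSet a) (n k : ℕ) (x : X) :
    killed P a n (fun z => ∫⁻ y, taboo P a a k y ∂(P z)) x ≤
      taboo P a a (n + (k + 1)) x + taboo P a a n x := by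
  have hle : (fun z => ∫⁻ y, taboo P a a k y ∂(P z)) ≤
      killedStep P a (taboo P a a k) + fun z => P z a := by
    intro z
    refine (lintegral_eq_killedStep_add ha _ z).trans_le (add_le_add le_rfl ?_)
    calc _ ≤ ∫⁻ y in a, 1 ∂(P z) := lintegral_mono fun y => taboo_le_one k y
      _ = P z a := by simp
  refine (killed_mono n hle x).trans ?_
  rw [killed_add ha n (measurable_killedStep ha (measurable_taboo ha ha k)),
    show taboo P a a (n + (k + 1)) = killed P a n (killedStep P a (taboo P a a k)) by
      rw [taboo, killed_add', killed_succ', ← taboo]]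
  rfl

/-- Excursions away from a recurrent set of finite measure carry the whole of an invariant
measure. -/
theorem tendsto_lintegral_taboo (hinv : P.Invariant π) (ha : MeasurableSet a) (hπa : π a ≠ ∞)
    (hhit : AlwaysHits P a) (hS : MeasurableSet S) (hπS : π S ≠ ∞) :
    Tendsto (fun n => ∫⁻ x, taboo P a S n x ∂π) atTop (𝓝 0) := by
  have hw : Tendsto (fun k => ∫⁻ x, taboo P a a k x ∂π) atTop (𝓝 0) := by
    simp_rw [lintegral_taboo_self hinv ha hπa]
    exact tendsto_lintegral_survival ha hπa hhit
  -- the part of `S` from which `a` is hit by time `m` with probability less than one half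
  set E : ℕ → Set X := fun m => S ∩ {x | (2 : ℝ≥0∞)⁻¹ < survival P a m x} with hE
  have hEm : ∀ m, MeasurableSet (E m) := fun m =>
    hS.inter (measurableSet_lt measurable_const (measurable_survival ha m))
  have hE0 : Tendsto (fun m => π (E m)) atTop (𝓝 0) := by
    have hanti : Antitone E := fun m m' hmm x hx => ⟨hx.1, lt_of_lt_of_le hx.2
      (survival_antitone x hmm)⟩
    have hemp : ⋂ m, E m = ∅ := by
      refine Set.eq_empty_of_forall_notMem fun x hx => ?_
      rw [Set.mem_iInter] at hx
      have h2 : (2 : ℝ≥0∞)⁻¹ ≤ 0 := ge_of_tendsto' (hhit x) fun m => (hx m).2.le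
      simp at h2
    have := tendsto_measure_iInter_atTop (μ := π) (fun m => (hEm m).nullMeasurableSet) hanti
      ⟨0, ne_top_of_le_ne_top hπS (measure_mono Set.inter_subset_left)⟩
    rwa [hemp, measure_empty] at this
  -- From a point of `S` outside `E m` the chain enters `a` within `m` steps with probability at
  -- least one half. So the mass reaching such points after `n` steps off `a` is at most twice a sum
  -- of masses of late entrances into `a`, which vanish by `hw` as `n → ∞` with `m` fixed.
  have hbound : ∀ m n, ∫⁻ x, taboo P a S n x ∂π ≤
      2 * ∑ k ∈ Finset.range m, (∫⁻ x, taboo P a a (n + (k + 1)) x ∂π +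
        ∫⁻ x, taboo P a a n x ∂π) + π (E m) := by
    intro m n
    have hsum : Measurable fun x => ∑ k ∈ Finset.range m, taboo P a a k x :=
      Finset.measurable_fun_sum _ fun k _ => measurable_taboo ha ha k
    have hstep : (fun x => P x S) ≤ (fun x => 2 * ∑ k ∈ Finset.range m,
        ∫⁻ y, taboo P a a k y ∂(P x)) + fun x => P x (E m) := by
      intro x
      have hpt : ∀ y, S.indicator 1 y ≤ 2 * ∑ k ∈ Finset.range m, taboo P a a k y +
          (E m).indicator (1 : X → ℝ≥0∞) y := by
        intro y
        by_cases hy : y ∈ S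
        · by_cases hy' : (2 : ℝ≥0∞)⁻¹ < survival P a m y
          · simp [hE, hy, hy']
          · have h1 := survival_add_sum_taboo (P := P) ha m y
            have : (2 : ℝ≥0∞)⁻¹ ≤ ∑ k ∈ Finset.range m, taboo P a a k y := by
              by_contra hlt
              push Not at hlt hy'
              have := ENNReal.add_lt_add_of_le_of_lt
                (ne_top_of_le_ne_top (by simp) hy') hy' hlt
              rw [h1, ENNReal.inv_two_add_inv_two] at this
              exact lt_irrefl _ this
            rw [Set.indicator_of_mem hy]
            refine le_add_right ?_
            calc (1 : ℝ≥0∞) = 2 * 2⁻¹ := (ENNReal.mul_inv_cancel (by simp) (by simp)).symm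
              _ ≤ _ := by gcongr
        · simp [hy]
      have := lintegral_mono (μ := P x) hpt
      rw [lintegral_indicator_one hS, lintegral_add_right _ (measurable_one.indicator (hEm m)),
        lintegral_indicator_one (hEm m), lintegral_const_mul _ hsum,
        lintegral_finsetSum _ fun k _ => measurable_taboo ha ha k] at this
      exact this
    have hmk : ∀ k, Measurable fun x => ∫⁻ y, taboo P a a k y ∂(P x) := fun k =>
      (measurable_taboo ha ha k).lintegral_kernel
    have hmks : Measurable fun x => ∑ k ∈ Finset.range m, ∫⁻ y, taboo P a a k y ∂(P x) :=
      Finset.measurable_fun_sum _ fun k _ => hmk k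
    have hmt : ∀ k, Measurable fun x => taboo P a a (n + (k + 1)) x + taboo P a a n x :=
      fun k => (measurable_taboo ha ha _).add (measurable_taboo ha ha _)
    calc ∫⁻ x, taboo P a S n x ∂π
        ≤ ∫⁻ x, (2 * ∑ k ∈ Finset.range m, (taboo P a a (n + (k + 1)) x + taboo P a a n x) +
            killed P a n (fun x => P x (E m)) x) ∂π := by
          refine lintegral_mono fun x => (killed_mono n hstep x).trans ?_
          rw [killed_add ha n (hmks.const_mul 2), killed_const_mul ha n hmks, killed_sum ha n hmk]
          refine add_le_add (mul_le_mul_right (Finset.sum_le_sum fun k _ =>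
            killed_lintegral_taboo_le ha n k x) 2) le_rfl
      _ = 2 * ∑ k ∈ Finset.range m, (∫⁻ x, taboo P a a (n + (k + 1)) x ∂π +
            ∫⁻ x, taboo P a a n x ∂π) + ∫⁻ x, killed P a n (fun x => P x (E m)) x ∂π := by
          rw [lintegral_add_right _ (measurable_killed ha n (P.measurable_coe (hEm m))),
            lintegral_const_mul _ (Finset.measurable_fun_sum _ fun k _ => hmt k),
            lintegral_finsetSum _ fun k _ => hmt k]
          simp_rw [lintegral_add_left (measurable_taboo ha ha _)]
      _ ≤ _ := by
          refine add_le_add le_rfl ((lintegral_killed_le hinv ha n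
            (P.measurable_coe (hEm m))).trans_eq ?_)
          exact lintegral_taboo_zero (a := a) hinv (hEm m)
  rw [ENNReal.tendsto_nhds_zero]
  intro ε hε
  have hε2 : 0 < ε / 2 := ENNReal.half_pos hε.ne'
  obtain ⟨m, hm⟩ := ((ENNReal.tendsto_nhds_zero.1 hE0) (ε / 2) hε2).exists
  have hlim : Tendsto (fun n => 2 * ∑ k ∈ Finset.range m,
      (∫⁻ x, taboo P a a (n + (k + 1)) x ∂π + ∫⁻ x, taboo P a a n x ∂π)) atTop (𝓝 0) := by
    have : Tendsto (fun n => ∑ k ∈ Finset.range m,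
      (∫⁻ x, taboo P a a (n + (k + 1)) x ∂π + ∫⁻ x, taboo P a a n x ∂π)) atTop
        (𝓝 (∑ k ∈ Finset.range m, (0 + 0))) :=
      tendsto_finsetSum _ fun k _ => ((tendsto_add_atTop_iff_nat (k + 1)).2 hw).add hw
    simpa using ENNReal.Tendsto.const_mul this (Or.inr (by simp : (2 : ℝ≥0∞) ≠ ∞))
  filter_upwards [(ENNReal.tendsto_nhds_zero.1 hlim) (ε / 2) hε2] with n hn
  calc _ ≤ _ := hbound m n
    _ ≤ ε / 2 + ε / 2 := add_le_add hn hm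
    _ = ε := ENNReal.add_halves ε

end Invariant

end Killed

/-! ### Recurrence of sets of positive invariant measure -/

section Recurrence

variable {X : Type*} [MeasurableSpace X] {P : Kernel X X} [IsMarkovKernel P]
  {π : Measure X} {a B S : Set X}

/-- The probability that the chain never visits `a` at a positive time. -/
noncomputable def escape (P : Kernel X X) (a : Set X) (x : X) : ℝ≥0∞ := ⨅ k, survival P a k x

theorem escape_le_one (x : X) : escape P a x ≤ 1 :=
  (iInf_le _ 0).trans (survival_le_one 0 x)

theorem tendsto_survival_escape (x : X) :
    Tendsto (fun k => survival P a k x) atTop (𝓝 (escape P a x)) :=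
  tendsto_atTop_iInf (survival_antitone x)

theorem killedStep_escape (ha : MeasurableSet a) (x : X) :
    killedStep P a (escape P a) x = escape P a x := by
  have h1 : Tendsto (fun k => killedStep P a (survival P a k) x) atTop
      (𝓝 (killedStep P a (escape P a) x)) :=
    tendsto_lintegral_of_dominated_convergence (fun _ => 1)
      (fun k => measurable_survival ha k) (fun k => ae_of_all _ fun y => survival_le_one k y)
      (by simp) (ae_of_all _ fun y => tendsto_survival_escape y)
  have h2 : Tendsto (fun k => survival P a (k + 1) x) atTop (𝓝 (escape P a x)) :=
    (tendsto_add_atTop_iff_nat 1).2 (tendsto_survival_escape x)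
  simp_rw [survival, killed_succ'] at h2
  exact tendsto_nhds_unique h1 h2

theorem killed_escape (ha : MeasurableSet a) (k : ℕ) : killed P a k (escape P a) = escape P a := by
  induction k with
  | zero => rfl
  | succ k ih => rw [killed_succ', ih]; exact funext fun x => killedStep_escape ha x

/-- The escape probability is subharmonic, so it may be bounded by its mean at the first positive
visit to `B`, where it is at most `t`. Paths that have not met `B` within `n` steps contribute at
most `s`, with weight tending to zero. -/
theorem escape_le_of_hits (ha : MeasurableSet a) (hB : MeasurableSet B) (hBhit : AlwaysHits P B)
    {s t : ℝ≥0∞} (hs : s ≠ ∞) (hes : ∀ x, escape P a x ≤ s) (heB : ∀ x ∈ B, escape P a x ≤ t)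
    (x : X) : escape P a x ≤ t := by
  have key : ∀ n x, escape P a x ≤ t * ∑ k ∈ Finset.range n, taboo P B B k x +
      s * survival P B n x := by
    intro n
    induction n with
    | zero => intro x; simpa [survival, killed] using hes x
    | succ n ih =>
      intro x
      have hmt : ∀ n, Measurable fun y => ∑ k ∈ Finset.range n, taboo P B B k y := fun n =>
        Finset.measurable_fun_sum _ fun k _ => measurable_taboo hB hB k
      calc escape P a x = killedStep P a (escape P a) x := (killedStep_escape ha x).symm
        _ ≤ ∫⁻ y, escape P a y ∂(P x) := killedStep_le _ _
        _ = killedStep P B (escape P a) x + ∫⁻ y in B, escape P a y ∂(P x) :=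
          lintegral_eq_killedStep_add hB _ _
        _ ≤ killedStep P B (fun y => t * ∑ k ∈ Finset.range n, taboo P B B k y +
              s * survival P B n y) x + ∫⁻ _ in B, t ∂(P x) :=
          add_le_add (killedStep_mono ih x) (setLIntegral_mono' hB heB)
        _ = _ := by
          rw [killedStep, lintegral_add_left ((hmt n).const_mul t), lintegral_const_mul _ (hmt n),
            lintegral_const_mul _ (measurable_survival hB n),
            lintegral_finsetSum _ fun k _ => measurable_taboo hB hB k, Finset.sum_range_succ']
          simp only [lintegral_const, Measure.restrict_apply, MeasurableSet.univ, Set.univ_inter]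
          simp only [taboo, survival, killed_succ', killed_zero, killedStep]
          ring
  have hlim : Tendsto (fun n => t + s * survival P B n x) atTop (𝓝 (t + s * 0)) :=
    tendsto_const_nhds.add (ENNReal.Tendsto.const_mul (hBhit x) (Or.inr hs))
  rw [mul_zero, add_zero] at hlim
  refine ge_of_tendsto' hlim fun n => (key n x).trans ?_
  refine add_le_add ?_ le_rfl
  refine mul_le_of_le_one_right' ?_
  rw [← survival_add_sum_taboo (P := P) hB n x]
  exact le_add_self

/-- Let `s` be the supremum of the escape probability. On `B` it is at most `s * c`, because
`escape` is fixed by `m` killed steps; by `escape_le_of_hits` this bound holds everywhere. Then `s ≤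
s * c` with `c < 1` forces `s = 0`. -/
theorem alwaysHits_of_survival_le (ha : MeasurableSet a) (hB : MeasurableSet B)
    (hBhit : AlwaysHits P B) {c : ℝ≥0∞} (hc : c < 1) (m : ℕ)
    (hBc : ∀ x ∈ B, survival P a m x ≤ c) : AlwaysHits P a := by
  set s := ⨆ x, escape P a x with hs
  have hs1 : s ≤ 1 := iSup_le escape_le_one
  have hst : s ≠ ∞ := ne_top_of_le_ne_top (by simp) hs1
  have hle : s ≤ s * c := iSup_le fun x =>
    escape_le_of_hits ha hB hBhit hst (fun x => le_iSup (escape P a) x) (fun x hx => by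
      rw [← killed_escape ha m]
      calc killed P a m (escape P a) x ≤ killed P a m (fun y => s * (1 : X → ℝ≥0∞) y) x :=
            killed_mono m (fun y => by simpa using le_iSup (escape P a) y) x
        _ = s * survival P a m x := by rw [killed_const_mul ha m measurable_one]; rfl
        _ ≤ s * c := mul_le_mul_right (hBc x hx) s) x
  have hs0 : s = 0 := by
    by_contra h0
    have : s * c < s * 1 := (ENNReal.mul_lt_mul_iff_right h0 hst).2 hc
    rw [mul_one] at this
    exact absurd (hle.trans_lt this) (lt_irrefl _)
  intro x
  have hx : escape P a x = 0 := le_antisymm ((le_iSup (escape P a) x).trans_eq hs0) bot_le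
  exact hx ▸ tendsto_survival_escape x

/-- In a Harris chain every set of positive invariant measure is recurrent. -/
theorem alwaysHits_of_pos [SigmaFinite π] (hinv : P.Invariant π) {φ : Measure X} (hφ : φ ≠ 0)
    (hhit : ∀ A, MeasurableSet A → 0 < φ A → AlwaysHits P A)
    (ha : MeasurableSet a) (hπa : 0 < π a) (hπa' : π a ≠ ∞) : AlwaysHits P a := by
  -- Either `a` is reachable from a `φ`-positive set, and some `φ`-positive subset has a uniform
  -- chance of reaching it; or `a` is unreachable from `φ`-almost every state, which contradicts `0
  -- < π a`.
  by_cases hH : ∃ m, 0 < φ {x | survival P a m x < 1}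
  · obtain ⟨m, hm⟩ := hH
    obtain ⟨u, -, hu1, hulim⟩ := exists_seq_strictMono_tendsto' (zero_lt_one' ℝ≥0∞)
    have hun : {x | survival P a m x < 1} ⊆ ⋃ k, {x | survival P a m x ≤ u k} := fun x hx => by
      obtain ⟨k, hk⟩ := (hulim.eventually (lt_mem_nhds hx)).exists
      exact Set.mem_iUnion.2 ⟨k, hk.le⟩
    obtain ⟨k, hk⟩ := exists_measure_pos_of_not_measure_iUnion_null
      (fun h0 => (hm.trans_le (measure_mono hun)).ne' h0)
    have hBm : MeasurableSet {x | survival P a m x ≤ u k} :=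
      measurableSet_le (measurable_survival ha m) measurable_const
    exact alwaysHits_of_survival_le ha hBm (hhit _ hBm hk) (hu1 k).2 m fun x hx => hx
  · push Not at hH
    have hNm : MeasurableSet {x | ∀ m, survival P a m x = 1} := by
      rw [Set.ofPred_forall]
      exact .iInter fun m => measurable_survival ha m (measurableSet_singleton 1)
    have hcov : (Set.univ : Set X) ⊆ (⋃ i, {x | ∀ m, survival P a m x = 1} ∩ spanningSets π i) ∪
        ⋃ m, {x | survival P a m x < 1} := by
      intro x _
      by_cases hx : ∀ m, survival P a m x = 1
      · have : x ∈ ⋃ i, spanningSets π i := by rw [iUnion_spanningSets]; trivial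
        obtain ⟨i, hi⟩ := Set.mem_iUnion.1 this
        exact Or.inl (Set.mem_iUnion.2 ⟨i, hx, hi⟩)
      · push Not at hx
        obtain ⟨m, hm⟩ := hx
        exact Or.inr (Set.mem_iUnion.2 ⟨m, lt_of_le_of_ne (survival_le_one m x) hm⟩)
    obtain ⟨i, hi⟩ : ∃ i, 0 < φ ({x | ∀ m, survival P a m x = 1} ∩ spanningSets π i) := by
      by_contra hcon
      push Not at hcon
      refine hφ (Measure.measure_univ_eq_zero.1 (measure_mono_null hcov (measure_union_null ?_ ?_)))
      · exact measure_iUnion_null fun i => le_antisymm (hcon i) bot_le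
      · exact measure_iUnion_null fun i => le_antisymm (hH i) bot_le
    -- `B` is recurrent of finite `π`-measure, and no path from it ever meets `a`. Its excursions
    -- carry the whole of `π` by `tendsto_lintegral_taboo`, so `π a` would have to vanish.
    set B := {x | ∀ m, survival P a m x = 1} ∩ spanningSets π i with hBdef
    have hB : MeasurableSet B := hNm.inter (measurableSet_spanningSets π i)
    have hπB : π B ≠ ∞ := ne_top_of_le_ne_top (measure_spanningSets_lt_top π i).ne
      (measure_mono Set.inter_subset_right)
    have hzero : ∀ x ∈ B, ∀ k, taboo P B a k x = 0 := by
      -- A visit to `a` at time `k + 1` forces a first visit at one of the times `1, …, k + 1`.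
      have hpow : ∀ k x, taboo P B a k x ≤ ∑ j ∈ Finset.range (k + 1), taboo P a a j x := by
        intro k
        induction k with
        | zero => intro x; simp [taboo, killed_zero]
        | succ k ih =>
          intro x
          have h1 : ∫⁻ y in aᶜ, taboo P B a k y ∂(P x) ≤
              ∑ j ∈ Finset.range (k + 1), taboo P a a (j + 1) x := by
            refine (lintegral_mono ih).trans_eq ?_
            rw [lintegral_finsetSum _ fun j _ => measurable_taboo ha ha j]
            simp only [taboo, killed_succ', killedStep]
          have h2 : ∫⁻ y in a, taboo P B a k y ∂(P x) ≤ taboo P a a 0 x :=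
            (lintegral_mono fun y => taboo_le_one k y).trans_eq (by simp [taboo, killed_zero])
          rw [Finset.sum_range_succ']
          calc taboo P B a (k + 1) x = killedStep P B (taboo P B a k) x := by
                rw [taboo, killed_succ', ← taboo]
            _ ≤ ∫⁻ y, taboo P B a k y ∂(P x) := killedStep_le _ _
            _ = _ := lintegral_eq_killedStep_add ha _ x
            _ ≤ _ := add_le_add h1 h2
      intro x hx k
      refine le_antisymm ((hpow k x).trans ?_) bot_le
      have h1 := survival_add_sum_taboo (P := P) ha (k + 1) x
      rw [hx.1 (k + 1)] at h1
      exact (ENNReal.add_right_inj (by simp)).1 (h1.trans (add_zero 1).symm) |>.le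
    have hconst : ∀ n, ∫⁻ x, taboo P B a n x ∂π = π a := by
      intro n
      rw [← lintegral_taboo_add_sum hinv hB ha n, Finset.sum_eq_zero, add_zero]
      intro k _
      rw [setLIntegral_congr_fun hB fun x hx => hzero x hx k]
      simp
    have hlim := tendsto_lintegral_taboo hinv hB hπB (hhit B hB hi) ha hπa'
    simp_rw [hconst] at hlim
    exact absurd (tendsto_nhds_unique hlim tendsto_const_nhds) (by simpa using hπa.ne)

end Recurrence

/-! ### Renewal at an atom: exit and entrance decompositions, Kac's formula -/

section Atom

variable {X : Type*} [MeasurableSpace X] {P : Kernel X X} {π : Measure X} {a S : Set X}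

instance isMarkovKernel_pow [IsMarkovKernel P] (n : ℕ) : IsMarkovKernel (P ^ n) := by
  induction n with
  | zero => rw [pow_zero, show (1 : Kernel X X) = Kernel.id from rfl]; infer_instance
  | succ n ih => rw [pow_succ, show P ^ n * P = (P ^ n) ∘ₖ P from rfl]; infer_instance

theorem IsAtom.killedStep_eq (hat : IsAtom P a) (h : X → ℝ≥0∞) {x y : X} (hx : x ∈ a)
    (hy : y ∈ a) : killedStep P a h x = killedStep P a h y := by
  rw [killedStep, killedStep, hat x hx y hy]

theorem IsAtom.killed_eq (hat : IsAtom P a) {h : X → ℝ≥0∞}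
    (hh : ∀ x ∈ a, ∀ y ∈ a, h x = h y) (k : ℕ) {x y : X} (hx : x ∈ a) (hy : y ∈ a) :
    killed P a k h x = killed P a k h y := by
  cases k with
  | zero => exact hh x hx y hy
  | succ k => rw [killed_succ']; exact hat.killedStep_eq _ hx hy

theorem IsAtom.taboo_eq (hat : IsAtom P a) (k : ℕ) {x y : X} (hx : x ∈ a) (hy : y ∈ a) :
    taboo P a S k x = taboo P a S k y :=
  hat.killed_eq (fun x hx y hy => by rw [hat x hx y hy]) k hx hy

theorem IsAtom.survival_eq (hat : IsAtom P a) (k : ℕ) {x y : X} (hx : x ∈ a) (hy : y ∈ a) :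
    survival P a k x = survival P a k y :=
  hat.killed_eq (fun _ _ _ _ => rfl) k hx hy

theorem setLIntegral_eq_of_forall_eq (ha : MeasurableSet a) {h : X → ℝ≥0∞} {z : X}
    (hh : ∀ x ∈ a, h x = h z) (ρ : Measure X) : ∫⁻ x in a, h x ∂ρ = h z * ρ a := by
  rw [setLIntegral_congr_fun ha hh]
  simp

/-- Last exit decomposition. -/
theorem IsAtom.lintegral_pow_eq (hat : IsAtom P a) (ha : MeasurableSet a) {z : X} (hz : z ∈ a)
    (n : ℕ) : ∀ {h : X → ℝ≥0∞}, Measurable h → (∀ x ∈ a, ∀ y ∈ a, h x = h y) → ∀ x,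
    ∫⁻ y, h y ∂((P ^ n) x) = killed P a n h x +
      ∑ k ∈ Finset.range n, (P ^ (n - k)) x a * killed P a k h z := by
  induction n with
  | zero =>
    intro h hh _ x
    rw [pow_zero, show (1 : Kernel X X) = Kernel.id from rfl, Kernel.lintegral_id' hh]
    simp [killed_zero]
  | succ n ih =>
    intro h hh hconst x
    -- The mass landing in `a` at the last step gives the term `k = 0`. The rest is the induction
    -- hypothesis for `killedStep P a h`, which is again constant on the atom.
    have hstep : ∀ y, ∫⁻ w, h w ∂(P y) = killedStep P a h y + h z * P y a := fun y => by
      rw [lintegral_eq_killedStep_add ha,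
        setLIntegral_eq_of_forall_eq ha (fun w hw => hconst w hw z hz) (P y)]
    have hcomp : ∀ {g : X → ℝ≥0∞}, Measurable g →
        ∫⁻ y, g y ∂((P ^ (n + 1)) x) = ∫⁻ y, ∫⁻ w, g w ∂(P y) ∂((P ^ n) x) := fun hg => by
      rw [pow_succ', show P * P ^ n = P ∘ₖ (P ^ n) from rfl, Kernel.lintegral_comp _ _ _ hg]
    have hPa : (P ^ (n + 1)) x a = ∫⁻ y, P y a ∂((P ^ n) x) := by
      have := hcomp (measurable_one.indicator ha)
      simpa [lintegral_indicator_one ha] using this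
    rw [hcomp hh]
    simp_rw [hstep]
    rw [lintegral_add_left (measurable_killedStep ha hh), lintegral_const_mul _
      (P.measurable_coe ha), ← hPa, ih (measurable_killedStep ha hh)
      (fun x hx y hy => hat.killedStep_eq h hx hy) x, Finset.sum_range_succ', ← killed_succ]
    simp only [← killed_succ, killed_zero, Nat.add_sub_add_right, Nat.sub_zero]
    ring

/-- The renewal equation for the survival probabilities of an atom. -/
theorem IsAtom.sum_pow_mul_survival [IsMarkovKernel P] (hat : IsAtom P a) (ha : MeasurableSet a)
    {z : X} (hz : z ∈ a) (n : ℕ) :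
    ∑ k ∈ Finset.range (n + 1), (P ^ (n - k)) z a * survival P a k z = 1 := by
  have := hat.lintegral_pow_eq ha hz n measurable_one (fun _ _ _ _ => rfl) z
  rw [Finset.sum_range_succ, Nat.sub_self, pow_zero, show (1 : Kernel X X) = Kernel.id from rfl,
    Kernel.id_apply, Measure.dirac_apply' _ ha, Set.indicator_of_mem hz]
  simp only [Pi.one_apply, lintegral_one, measure_univ] at this
  rw [this, add_comm]
  simp [survival]

theorem IsAtom.pow_succ_eq_sum (hat : IsAtom P a) (ha : MeasurableSet a) (hS : MeasurableSet S)
    {z : X} (hz : z ∈ a) (n : ℕ) :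
    (P ^ (n + 1)) z S = ∑ k ∈ Finset.range (n + 1), (P ^ (n - k)) z a * taboo P a S k z := by
  have := hat.lintegral_pow_eq ha hz n (P.measurable_coe hS)
    (fun x hx y hy => by rw [hat x hx y hy]) z
  rw [pow_succ', show P * P ^ n = P ∘ₖ (P ^ n) from rfl, Kernel.comp_apply' _ _ _ hS, this,
    Finset.sum_range_succ, Nat.sub_self, pow_zero, show (1 : Kernel X X) = Kernel.id from rfl,
    Kernel.id_apply, Measure.dirac_apply' _ ha, Set.indicator_of_mem hz, add_comm]
  simp [taboo]

/-- First entrance decomposition. -/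
theorem IsAtom.pow_succ_eq_taboo_add (hat : IsAtom P a) (ha : MeasurableSet a)
    (hS : MeasurableSet S) {z : X} (hz : z ∈ a) (n : ℕ) : ∀ x,
    (P ^ (n + 1)) x S = taboo P a S n x +
      ∑ j ∈ Finset.range n, taboo P a a j x * (P ^ (n - j)) z S := by
  induction n with
  | zero => intro x; simp [taboo, killed_zero]
  | succ n ih =>
    intro x
    have hcomp : ∀ m x, (P ^ (m + 1)) x S = ∫⁻ y, (P ^ m) y S ∂(P x) := fun m x => by
      rw [pow_succ, show P ^ m * P = (P ^ m) ∘ₖ P from rfl, Kernel.comp_apply' _ _ _ hS]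
    have hc : ∀ y ∈ a, (P ^ (n + 1)) y S = (P ^ (n + 1)) z S := fun y hy => by
      rw [hcomp, hcomp, hat y hy z hz]
    rw [hcomp (n + 1), lintegral_eq_killedStep_add ha, setLIntegral_eq_of_forall_eq ha hc (P x),
      Finset.sum_range_succ', Nat.sub_zero]
    generalize (P ^ (n + 1)) z S = c
    simp_rw [killedStep, ih]
    rw [lintegral_add_left (measurable_taboo ha hS n), lintegral_finsetSum _ fun j _ =>
      (measurable_taboo ha ha j).mul_const _]
    simp_rw [lintegral_mul_const _ (measurable_taboo ha ha _)]
    simp only [taboo, killed_succ', killed_zero, killedStep, Nat.add_sub_add_right]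
    ring

/-- Kac's formula: the invariant measure is the expected occupation measure of an excursion. -/
theorem IsAtom.tendsto_sum_taboo_mul [IsMarkovKernel P] (hat : IsAtom P a) (hinv : P.Invariant π)
    (ha : MeasurableSet a) (hπa : π a ≠ ∞) (hhit : AlwaysHits P a) (hS : MeasurableSet S)
    (hπS : π S ≠ ∞) {z : X} (hz : z ∈ a) :
    Tendsto (fun n => ∑ k ∈ Finset.range n, taboo P a S k z * π a) atTop (𝓝 (π S)) := by
  have h0 := tendsto_lintegral_taboo hinv ha hπa hhit hS hπS
  have hle : ∀ n, ∫⁻ x, taboo P a S n x ∂π ≤ π S := fun n => by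
    rw [← lintegral_taboo_add_sum hinv ha hS n]; exact le_self_add
  have heq : ∀ n, ∑ k ∈ Finset.range n, taboo P a S k z * π a =
      π S - ∫⁻ x, taboo P a S n x ∂π := fun n => by
    have := lintegral_taboo_add_sum hinv ha hS n
    simp_rw [setLIntegral_eq_of_forall_eq ha (fun x hx => hat.taboo_eq _ hx hz)] at this
    rw [← this]
    exact (ENNReal.add_sub_cancel_left (ne_top_of_le_ne_top hπS (hle n))).symm
  simp_rw [heq]
  have := ENNReal.Tendsto.sub (tendsto_const_nhds (x := π S)) h0 (Or.inl hπS)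
  simpa using this

end Atom

/-! ### Limits of convolution averages -/

section Convolution

/-- This is a weighted average of the `c k`. Each weight is at most one and the total weight
diverges, so any fixed block of small `k` is negligible and only the limit of `c` matters. -/
theorem tendsto_sum_mul_div {u c : ℕ → ℝ} {l : ℝ} (hu0 : ∀ n, 0 ≤ u n) (hu1 : ∀ n, u n ≤ 1)
    (hA : Tendsto (fun n => ∑ i ∈ Finset.range (n + 1), u i) atTop atTop)
    (hc : Tendsto c atTop (𝓝 l)) :
    Tendsto (fun n => (∑ k ∈ Finset.range (n + 1), u (n - k) * c k) /
      ∑ i ∈ Finset.range (n + 1), u i) atTop (𝓝 l) := by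
  obtain ⟨M, hM⟩ : ∃ M, ∀ n, |c n - l| ≤ M := by
    have h0 : Tendsto (fun n => |c n - l|) atTop (𝓝 |l - l|) := (hc.sub_const l).abs
    obtain ⟨M, hM⟩ := h0.bddAbove_range
    exact ⟨M, fun n => hM ⟨n, rfl⟩⟩
  have hM0 : 0 ≤ M := (abs_nonneg _).trans (hM 0)
  rw [Metric.tendsto_atTop]
  intro ε hε
  obtain ⟨N, hN⟩ := (Metric.tendsto_atTop.1 hc) (ε / 2) (by positivity)
  obtain ⟨N', hN'⟩ := (hA.eventually_gt_atTop (max 0 (2 * (M * N) / ε))).exists_forall_of_atTop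
  refine ⟨N', fun n hn => ?_⟩
  have hAn := hN' n hn
  set A := ∑ i ∈ Finset.range (n + 1), u i with hAdef
  have hA0 : 0 < A := (le_max_left _ _).trans_lt hAn
  have hrefl : ∑ k ∈ Finset.range (n + 1), u (n - k) = A :=
    Finset.sum_range_reflect u (n + 1)
  have hdiff : (∑ k ∈ Finset.range (n + 1), u (n - k) * c k) / A - l =
      (∑ k ∈ Finset.range (n + 1), u (n - k) * (c k - l)) / A := by
    rw [eq_div_iff hA0.ne', sub_mul, div_mul_cancel₀ _ hA0.ne', ← hrefl, Finset.mul_sum,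
      ← Finset.sum_sub_distrib]
    exact Finset.sum_congr rfl fun k _ => by ring
  rw [Real.dist_eq, hdiff, abs_div, abs_of_pos hA0, div_lt_iff₀ hA0]
  have hpt : ∀ k ∈ Finset.range (n + 1), |u (n - k) * (c k - l)| ≤
      u (n - k) * (ε / 2) + (if k < N then M else 0) := by
    intro k _
    rw [abs_mul, abs_of_nonneg (hu0 _)]
    split_ifs with hk
    · have h1 : u (n - k) * |c k - l| ≤ 1 * M :=
        mul_le_mul (hu1 _) (hM k) (abs_nonneg _) zero_le_one
      have h2 : 0 ≤ u (n - k) * (ε / 2) := mul_nonneg (hu0 _) (by positivity)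
      linarith
    · rw [add_zero]
      have := hN k (not_lt.1 hk)
      rw [Real.dist_eq] at this
      exact mul_le_mul_of_nonneg_left this.le (hu0 _)
  have hcard : ∑ k ∈ Finset.range (n + 1), (if k < N then M else 0) ≤ M * N := by
    rw [← Finset.sum_filter, Finset.sum_const, nsmul_eq_mul, mul_comm]
    refine mul_le_mul_of_nonneg_left ?_ hM0
    rw [Nat.cast_le, ← Finset.card_range N]
    refine Finset.card_le_card fun k hk => ?_
    simpa using (Finset.mem_filter.1 hk).2
  have h2 : M * N < A * (ε / 2) := by
    have h1 := (le_max_right _ _).trans_lt hAn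
    rw [div_lt_iff₀ hε] at h1
    linarith
  calc |∑ k ∈ Finset.range (n + 1), u (n - k) * (c k - l)|
      ≤ ∑ k ∈ Finset.range (n + 1), |u (n - k) * (c k - l)| := Finset.abs_sum_le_sum_abs _ _
    _ ≤ ∑ k ∈ Finset.range (n + 1), (u (n - k) * (ε / 2) + (if k < N then M else 0)) :=
        Finset.sum_le_sum hpt
    _ ≤ A * (ε / 2) + M * N := by
        rw [Finset.sum_add_distrib, ← Finset.sum_mul, hrefl]
        linarith
    _ < ε * A := by linarith

end Convolution

/-! ### Karamata's theorem, Abelian half -/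

section Abelian

/-- A Potter-type bound, used for domination. Since 2^β ≤ 2 < 4, doubling a large argument
multiplies `A` by at most 4. Iterating with 2^n ≤ y < 2^(n+1) gives 4^(n+1) ≤ 4y²; for y ≤ 1
monotonicity suffices. -/
theorem RegularlyVarying.exists_le {A : ℝ → ℝ} {β : ℝ} (hA : RegularlyVarying A β)
    (hmono : Monotone A) (hβ1 : β ≤ 1) :
    ∀ᶠ t in atTop, ∀ y > 0, A (t * y) / A t ≤ 1 + 4 * y ^ 2 := by
  have h2 : ∀ᶠ t in atTop, A (2 * t) / A t < 4 := by
    refine (hA.2 2 two_pos).eventually (gt_mem_nhds ?_)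
    calc (2 : ℝ) ^ β ≤ 2 ^ (1 : ℝ) := Real.rpow_le_rpow_of_exponent_le one_le_two hβ1
      _ < 4 := by norm_num
  obtain ⟨t₀, ht₀⟩ := (h2.and (hA.1.and (eventually_gt_atTop 0))).exists_forall_of_atTop
  filter_upwards [eventually_ge_atTop t₀] with t ht y hy
  have hpos := (ht₀ t ht).2.1
  have htpos := (ht₀ t ht).2.2
  have hiter : ∀ n : ℕ, A (2 ^ n * t) ≤ 4 ^ n * A t := by
    intro n
    induction n with
    | zero => simp
    | succ n ih =>
      have hle : t ≤ 2 ^ n * t := le_mul_of_one_le_left htpos.le (one_le_pow₀ one_le_two)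
      have h1 := (ht₀ (2 ^ n * t) (ht.trans hle))
      have h3 := h1.1.le
      rw [div_le_iff₀ h1.2.1] at h3
      calc A (2 ^ (n + 1) * t) = A (2 * (2 ^ n * t)) := by ring_nf
        _ ≤ 4 * A (2 ^ n * t) := h3
        _ ≤ 4 * (4 ^ n * A t) := by linarith
        _ = 4 ^ (n + 1) * A t := by ring
  rw [div_le_iff₀ hpos]
  rcases le_total y 1 with hy1 | hy1
  · have : A (t * y) ≤ A t := hmono (mul_le_of_le_one_right htpos.le hy1)
    nlinarith [mul_nonneg (sq_nonneg y) hpos.le]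
  · obtain ⟨n, hn1, hn2⟩ := exists_nat_pow_near hy1 one_lt_two
    calc A (t * y) ≤ A (2 ^ (n + 1) * t) := by
          refine hmono ?_
          rw [mul_comm]
          exact mul_le_mul_of_nonneg_right hn2.le htpos.le
      _ ≤ 4 ^ (n + 1) * A t := hiter _
      _ = 4 * (2 ^ n) ^ 2 * A t := by
          rw [← pow_mul, mul_comm n 2, pow_mul, pow_succ]; norm_num; ring_nf; simp
      _ ≤ 4 * y ^ 2 * A t := by gcongr
      _ ≤ (1 + 4 * y ^ 2) * A t := by nlinarith

/-- The Abelian half of Karamata's theorem. -/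
theorem RegularlyVarying.tendsto_integral_exp {A : ℝ → ℝ} {β : ℝ} (hA : RegularlyVarying A β)
    (hmono : Monotone A) (hnonneg : ∀ t, 0 ≤ A t) (hβ0 : 0 ≤ β) (hβ1 : β ≤ 1) :
    Tendsto (fun t => (∫ y in Set.Ioi (0 : ℝ), Real.exp (-y) * A (t * y)) / A t) atTop
      (𝓝 (Real.Gamma (1 + β))) := by
  rw [Real.Gamma_eq_integral (by linarith)]
  simp_rw [div_eq_mul_inv, ← integral_mul_const]
  refine tendsto_integral_filter_of_dominated_convergence
    (fun y => Real.exp (-y) * (1 + 4 * y ^ 2)) ?_ ?_ ?_ ?_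
  · refine Eventually.of_forall fun t => Measurable.aestronglyMeasurable ?_
    have : Measurable fun y => A (t * y) := hmono.measurable.comp (measurable_const_mul t)
    exact ((Real.measurable_exp.comp measurable_neg).mul this).mul_const _
  · filter_upwards [hA.exists_le hmono hβ1, hA.1] with t ht htpos
    filter_upwards [ae_restrict_mem measurableSet_Ioi] with y hy
    have hnn : 0 ≤ A (t * y) / A t := div_nonneg (hnonneg _) htpos.le
    rw [mul_assoc, ← div_eq_mul_inv, Real.norm_of_nonneg (mul_nonneg (Real.exp_pos _).le hnn)]
    exact mul_le_mul_of_nonneg_left (ht y hy) (Real.exp_pos _).le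
  · have h1 := Real.GammaIntegral_convergent (s := 1) one_pos
    have h3 := Real.GammaIntegral_convergent (s := 3) three_pos
    refine (h1.add (h3.const_mul 4)).congr_fun (fun y hy => ?_) measurableSet_Ioi
    have : y ^ ((3 : ℝ) - 1) = y ^ 2 := by rw [← Real.rpow_natCast]; norm_num
    simp only [Pi.add_apply, this, sub_self, Real.rpow_zero]
    ring
  · filter_upwards [ae_restrict_mem measurableSet_Ioi] with y hy
    have := (hA.2 y hy).const_mul (Real.exp (-y))
    simp_rw [mul_assoc, ← div_eq_mul_inv, mul_comm _ y]
    simpa using this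

end Abelian

/-! ### Laplace transforms of sequences -/

section Laplace

theorem summable_mul_exp {u : ℕ → ℝ} (hu0 : ∀ n, 0 ≤ u n) (hu1 : ∀ n, u n ≤ 1) {t : ℝ}
    (ht : 0 < t) : Summable fun k : ℕ => u k * Real.exp (-(k / t)) := by
  have hgeo : Summable fun k : ℕ => Real.exp (-t⁻¹) ^ k :=
    summable_geometric_of_lt_one (Real.exp_pos _).le (Real.exp_lt_one_iff.2 (by simpa using ht))
  refine Summable.of_nonneg_of_le (fun k => mul_nonneg (hu0 k) (Real.exp_pos _).le)
    (fun k => ?_) hgeo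
  rw [← Real.exp_nat_mul]
  calc u k * Real.exp (-(k / t)) ≤ 1 * Real.exp (-(k / t)) :=
        mul_le_mul_of_nonneg_right (hu1 k) (Real.exp_pos _).le
    _ = Real.exp (k * -t⁻¹) := by rw [one_mul]; congr 1; ring

/-- Write e^{-k/t} as the integral of e^{-y} over y ≥ k/t and exchange sum and integral; for given y
the surviving terms are those with k ≤ ty. -/
theorem tsum_mul_exp_eq_integral {u : ℕ → ℝ} (hu0 : ∀ n, 0 ≤ u n) (hu1 : ∀ n, u n ≤ 1) {t : ℝ}
    (ht : 0 < t) :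
    ∑' k : ℕ, u k * Real.exp (-(k / t)) =
      ∫ y in Set.Ioi (0 : ℝ), Real.exp (-y) * ∑ k ∈ Finset.range (⌊t * y⌋₊ + 1), u k := by
  rw [← integral_Ici_eq_integral_Ioi]
  set F : ℕ → ℝ → ℝ := fun k => (Set.Ici (k / t : ℝ)).indicator fun y => u k * Real.exp (-y)
    with hF
  have hIci : ∀ k : ℕ, Set.Ici (0 : ℝ) ∩ Set.Ici (k / t : ℝ) = Set.Ici (k / t : ℝ) := fun k =>
    Set.inter_eq_right.2 (Set.Ici_subset_Ici.2 (by positivity))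
  have hint : ∀ k, ∫ y in Set.Ici (0 : ℝ), F k y = u k * Real.exp (-(k / t)) := by
    intro k
    rw [hF, setIntegral_indicator measurableSet_Ici, hIci, integral_Ici_eq_integral_Ioi,
      integral_const_mul, integral_exp_neg_Ioi]
  have hFint : ∀ k, Integrable (F k) (volume.restrict (Set.Ici 0)) := by
    intro k
    refine IntegrableOn.integrable_indicator ?_ measurableSet_Ici
    rw [IntegrableOn, Measure.restrict_restrict measurableSet_Ici, Set.inter_comm, hIci]
    exact (((integrableOn_Ici_iff_integrableOn_Ioi).2 (integrableOn_exp_neg_Ioi _))).const_mul _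
  have hnn : ∀ k y, 0 ≤ F k y := fun k y =>
    Set.indicator_nonneg (fun y _ => mul_nonneg (hu0 k) (Real.exp_pos _).le) y
  have hsum : Summable fun k => ∫ y in Set.Ici (0 : ℝ), ‖F k y‖ := by
    simp_rw [Real.norm_of_nonneg (hnn _ _), hint]
    exact summable_mul_exp hu0 hu1 ht
  rw [← tsum_congr hint, integral_tsum_of_summable_integral_norm hFint hsum]
  refine setIntegral_congr_fun measurableSet_Ici fun y hy => ?_
  have hmem : ∀ k : ℕ, y ∈ Set.Ici (k / t : ℝ) ↔ k ∈ Finset.range (⌊t * y⌋₊ + 1) := fun k => by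
    rw [Set.mem_Ici, Finset.mem_range, Nat.lt_succ_iff, Nat.le_floor_iff (mul_nonneg ht.le hy),
      div_le_iff₀ ht, mul_comm]
  change ∑' k, F k y = _
  rw [tsum_eq_sum (s := Finset.range (⌊t * y⌋₊ + 1)) fun k hk => by
    rw [hF]; exact Set.indicator_of_notMem (fun h => hk ((hmem k).1 h)) _, Finset.mul_sum]
  refine Finset.sum_congr rfl fun k hk => ?_
  rw [hF]
  simp only
  rw [Set.indicator_of_mem ((hmem k).2 hk), mul_comm]

end Laplace

/-! ### Karamata's theorem, Tauberian half -/

section Tauberian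

/-- The measure on `[0, ∞)` with Laplace transform `r ↦ r ^ (-ρ)`. -/
theorem exists_measure_laplace {ρ : ℝ} (hρ : 0 ≤ ρ) : ∃ η : Measure ℝ,
    (∀ᵐ x ∂η, 0 ≤ x) ∧
    (∀ r : ℝ, 0 < r → Integrable (fun x => Real.exp (-(r * x))) η ∧
      ∫ x, Real.exp (-(r * x)) ∂η = (1 / r) ^ ρ) ∧
    ∀ b : ℝ, 0 < b → η (Set.Iic b) = ENNReal.ofReal (b ^ ρ / Real.Gamma (1 + ρ)) := by
  -- For `ρ = 0` the measure is the unit mass at zero, otherwise it has density x^(ρ-1)/Γ(ρ). The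
  -- degenerate case is needed for `β = 1`, where the tails have exponent `1 - β = 0`.
  rcases hρ.eq_or_lt with rfl | hρ
  · refine ⟨Measure.dirac 0, ?_, ?_, ?_⟩
    · rw [ae_dirac_iff measurableSet_Ici]
    · intro r _
      exact ⟨integrable_dirac (by simp), by simp⟩
    · intro b hb
      simp [hb.le]
  · have hΓ := Real.Gamma_pos_of_pos hρ
    set d : ℝ → ℝ≥0 := fun x => Real.toNNReal (x ^ (ρ - 1) / Real.Gamma ρ) with hd
    have hdm : Measurable d := by fun_prop
    refine ⟨(volume.restrict (Set.Ioi 0)).withDensity fun x => d x, ?_, ?_, ?_⟩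
    · refine (withDensity_absolutelyContinuous _ _).ae_le ?_
      filter_upwards [ae_restrict_mem measurableSet_Ioi] with x hx using hx.le
    · intro r hr
      have hpt : ∀ x ∈ Set.Ioi (0 : ℝ), d x • Real.exp (-(r * x)) =
          (Real.Gamma ρ)⁻¹ * (x ^ (ρ - 1) * Real.exp (-(r * x))) := by
        intro x hx
        rw [NNReal.smul_def, hd, Real.coe_toNNReal _
          (div_nonneg (Real.rpow_nonneg (le_of_lt hx) _) hΓ.le), smul_eq_mul]
        ring
      have hval := Real.integral_rpow_mul_exp_neg_mul_Ioi hρ hr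
      constructor
      · rw [integrable_withDensity_iff_integrable_smul hdm]
        refine IntegrableOn.congr_fun (f := fun x => (Real.Gamma ρ)⁻¹ *
          (x ^ (ρ - 1) * Real.exp (-(r * x)))) ?_ (fun x hx => (hpt x hx).symm) measurableSet_Ioi
        refine Integrable.const_mul ?_ _
        -- Without integrability the integral would be zero by convention, but its known value is
        -- positive.
        by_contra hcon
        rw [integral_undef hcon] at hval
        have : 0 < (1 / r) ^ ρ * Real.Gamma ρ := by positivity
        linarith
      · rw [integral_withDensity_eq_integral_smul hdm,
          setIntegral_congr_fun measurableSet_Ioi hpt, integral_const_mul, hval]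
        field_simp
    · intro b hb
      rw [withDensity_apply _ measurableSet_Iic, Measure.restrict_restrict measurableSet_Iic,
        Set.Iic_inter_Ioi]
      have hint : IntegrableOn (fun x : ℝ => x ^ (ρ - 1) / Real.Gamma ρ) (Set.Ioc 0 b) := by
        have := (intervalIntegral.intervalIntegrable_rpow' (a := 0) (b := b)
          (by linarith : -1 < ρ - 1)).div_const (Real.Gamma ρ)
        rwa [intervalIntegrable_iff_integrableOn_Ioc_of_le hb.le] at this
      change ∫⁻ x in Set.Ioc 0 b, ENNReal.ofReal (x ^ (ρ - 1) / Real.Gamma ρ) = _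
      rw [← ofReal_integral_eq_lintegral_ofReal hint, ← intervalIntegral.integral_of_le hb.le,
        intervalIntegral.integral_div, integral_rpow (Or.inl (by linarith))]
      · congr 1
        rw [add_comm 1 ρ, Real.Gamma_add_one hρ.ne', sub_add_cancel, Real.zero_rpow hρ.ne']
        field_simp
        ring
      · filter_upwards [ae_restrict_mem measurableSet_Ioc] with x hx
        exact div_nonneg (Real.rpow_nonneg hx.1.le _) hΓ.le

/-- Continuous approximations of the indicator function of a half-line. -/
theorem exists_continuous_ramp {a b : ℝ} (hab : a < b) : ∃ g : ℝ → ℝ, Continuous g ∧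
    ∀ x, 0 ≤ Real.exp (-x) * g (Real.exp (-x)) ∧ Real.exp (-x) * g (Real.exp (-x)) ≤ 1 ∧
      (x ≤ a → Real.exp (-x) * g (Real.exp (-x)) = 1) ∧
      (b ≤ x → Real.exp (-x) * g (Real.exp (-x)) = 0) := by
  have hlt : Real.exp (-b) < Real.exp (-a) := Real.exp_lt_exp.2 (by linarith)
  have hpos : 0 < Real.exp (-a) - Real.exp (-b) := sub_pos.2 hlt
  have hmax : ∀ y, 0 < max y (Real.exp (-b)) := fun y => lt_max_of_lt_right (Real.exp_pos _)
  -- A linear ramp in y = e^{-x}, divided by y to cancel the weight e^{-x}. The maximum in the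
  -- denominator keeps the quotient continuous and differs from y only where the ramp is zero.
  refine ⟨fun y => max 0 (min 1 ((y - Real.exp (-b)) / (Real.exp (-a) - Real.exp (-b)))) /
    max y (Real.exp (-b)), ?_, fun x => ?_⟩
  · refine Continuous.div (by fun_prop) (by fun_prop) fun y => (hmax y).ne'
  · set y := Real.exp (-x) with hy
    have hy0 : 0 < y := Real.exp_pos _
    have hle : y / max y (Real.exp (-b)) ≤ 1 := (div_le_one (hmax y)).2 (le_max_left _ _)
    have hnn : 0 ≤ y / max y (Real.exp (-b)) := div_nonneg hy0.le (hmax y).le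
    set c := max 0 (min 1 ((y - Real.exp (-b)) / (Real.exp (-a) - Real.exp (-b)))) with hc
    have hc0 : 0 ≤ c := le_max_left _ _
    have hc1 : c ≤ 1 := max_le zero_le_one (min_le_left _ _)
    have heq : y * (c / max y (Real.exp (-b))) = c * (y / max y (Real.exp (-b))) := by ring
    simp only [← hc]
    rw [heq]
    refine ⟨mul_nonneg hc0 hnn, mul_le_one₀ hc1 hnn hle, fun hxa => ?_, fun hbx => ?_⟩
    · have hya : Real.exp (-a) ≤ y := Real.exp_le_exp.2 (by linarith)
      have h1 : c = 1 := by
        rw [hc, min_eq_left ((one_le_div hpos).2 (by linarith)), max_eq_right zero_le_one]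
      rw [h1, max_eq_left (hlt.le.trans hya), div_self hy0.ne', one_mul]
    · have hyb : y ≤ Real.exp (-b) := Real.exp_le_exp.2 (by linarith)
      have h1 : c = 0 := by
        rw [hc, max_eq_left]
        exact (min_le_right _ _).trans (div_nonpos_of_nonpos_of_nonneg (by linarith) hpos.le)
      rw [h1, zero_mul]

variable {q : ℕ → ℝ} {ρ : ℝ}

/-- The Laplace transform of the sequence `q`, as a function of the reciprocal variable. -/
noncomputable def laplace (q : ℕ → ℝ) (t : ℝ) : ℝ := ∑' k : ℕ, q k * Real.exp (-(k / t))

theorem summable_mul_exp_mul {t : ℝ} (hq0 : ∀ n, 0 ≤ q n) (ht : 0 < t)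
    (hs : Summable fun k : ℕ => q k * Real.exp (-(k / t))) {g : ℝ → ℝ} {C : ℝ}
    (hg : ∀ y ∈ Set.Icc (0 : ℝ) 1, |g y| ≤ C) :
    Summable fun k : ℕ => q k * (Real.exp (-(k / t)) * g (Real.exp (-(k / t)))) := by
  refine Summable.of_norm_bounded (hs.mul_left C) fun k => ?_
  have hk : Real.exp (-(k / t)) ∈ Set.Icc (0 : ℝ) 1 :=
    ⟨(Real.exp_pos _).le, Real.exp_le_one_iff.2 (neg_nonpos.2 (by positivity))⟩
  have h0 : 0 ≤ q k * Real.exp (-(k / t)) := mul_nonneg (hq0 k) hk.1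
  rw [← mul_assoc, norm_mul, Real.norm_of_nonneg h0, mul_comm C]
  exact mul_le_mul_of_nonneg_left (hg _ hk) h0

/-- Karamata's method: the monomial y^i changes the weight e^{-x} into e^{-(i+1)x}, that is, it
evaluates `laplace q` at t/(i+1). Regular variation gives the limit (1/(i+1))^ρ, which is the
Laplace transform of `η` at i+1. -/
theorem tendsto_tsum_polynomial
    (hs : ∀ t > 0, Summable fun k : ℕ => q k * Real.exp (-(k / t)))
    (hrv : RegularlyVarying (laplace q) ρ) {η : Measure ℝ}
    (hη : ∀ r : ℝ, 0 < r → Integrable (fun x => Real.exp (-(r * x))) η ∧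
      ∫ x, Real.exp (-(r * x)) ∂η = (1 / r) ^ ρ) (p : Polynomial ℝ) :
    Integrable (fun x => Real.exp (-x) * p.eval (Real.exp (-x))) η ∧
    Tendsto (fun t => (∑' k : ℕ, q k * (Real.exp (-(k / t)) * p.eval (Real.exp (-(k / t))))) /
      laplace q t) atTop (𝓝 (∫ x, Real.exp (-x) * p.eval (Real.exp (-x)) ∂η)) := by
  have hexp : ∀ x : ℝ, Real.exp (-x) * p.eval (Real.exp (-x)) =
      ∑ i ∈ Finset.range (p.natDegree + 1), p.coeff i * Real.exp (-((i + 1 : ℝ) * x)) := by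
    intro x
    rw [Polynomial.eval_eq_sum_range, Finset.mul_sum]
    refine Finset.sum_congr rfl fun i _ => ?_
    rw [← Real.exp_nat_mul, mul_left_comm, ← Real.exp_add]
    congr 2
    ring
  have hpos : ∀ i : ℕ, (0 : ℝ) < i + 1 := fun i => by positivity
  simp_rw [hexp]
  refine ⟨integrable_finsetSum _ fun i _ => (hη _ (hpos i)).1.const_mul _, ?_⟩
  rw [integral_finsetSum _ fun i _ => (hη _ (hpos i)).1.const_mul _]
  simp_rw [integral_const_mul, (hη _ (hpos _)).2]
  have hlim : Tendsto (fun t => ∑ i ∈ Finset.range (p.natDegree + 1),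
      p.coeff i * (laplace q ((1 / (i + 1 : ℝ)) * t) / laplace q t)) atTop
      (𝓝 (∑ i ∈ Finset.range (p.natDegree + 1), p.coeff i * (1 / (i + 1 : ℝ)) ^ ρ)) :=
    tendsto_finsetSum _ fun i _ => (hrv.2 _ (by have := hpos i; positivity)).const_mul _
  refine hlim.congr' ?_
  filter_upwards [eventually_gt_atTop 0] with t ht
  have hterm : ∀ i k : ℕ, Real.exp (-((i + 1 : ℝ) * (k / t))) =
      Real.exp (-(k / (1 / (i + 1 : ℝ) * t))) := fun i k => by
    have := hpos i
    congr 2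
    field_simp
  have hsi : ∀ i : ℕ, Summable fun k : ℕ => q k * Real.exp (-((i + 1 : ℝ) * (k / t))) := fun i => by
    simp_rw [hterm]
    exact hs _ (by have := hpos i; positivity)
  simp_rw [Finset.mul_sum, mul_left_comm (q _)]
  rw [Summable.tsum_finsetSum fun i _ => (hsi i).mul_left _, Finset.sum_div]
  refine Finset.sum_congr rfl fun i _ => ?_
  rw [tsum_mul_left, mul_div_assoc, laplace]
  simp_rw [hterm]

/-- Weierstrass approximation on [0, 1]. Replacing `g` by a polynomial within ε/3 moves each side by
at most ε/3, since the weight e^{-x} has total mass one under `η` and, after division by `laplace q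
t`, in the sum. -/
theorem tendsto_tsum_continuous (hq0 : ∀ n, 0 ≤ q n)
    (hs : ∀ t > 0, Summable fun k : ℕ => q k * Real.exp (-(k / t)))
    (hrv : RegularlyVarying (laplace q) ρ) {η : Measure ℝ} (hη0 : ∀ᵐ x ∂η, 0 ≤ x)
    (hη : ∀ r : ℝ, 0 < r → Integrable (fun x => Real.exp (-(r * x))) η ∧
      ∫ x, Real.exp (-(r * x)) ∂η = (1 / r) ^ ρ) {g : ℝ → ℝ} (hg : Continuous g) :
    Tendsto (fun t => (∑' k : ℕ, q k * (Real.exp (-(k / t)) * g (Real.exp (-(k / t))))) /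
      laplace q t) atTop (𝓝 (∫ x, Real.exp (-x) * g (Real.exp (-x)) ∂η)) := by
  have hη1 := hη 1 one_pos
  simp only [one_mul, div_one, Real.one_rpow] at hη1
  obtain ⟨C, hC⟩ := isCompact_Icc.exists_bound_of_continuousOn (s := Set.Icc (0 : ℝ) 1)
    hg.continuousOn
  have hmem : ∀ x : ℝ, 0 ≤ x → Real.exp (-x) ∈ Set.Icc (0 : ℝ) 1 := fun x hx =>
    ⟨(Real.exp_pos _).le, Real.exp_le_one_iff.2 (by linarith)⟩
  have hgint : Integrable (fun x => Real.exp (-x) * g (Real.exp (-x))) η := by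
    refine (hη1.1.const_mul C).mono' (by fun_prop) ?_
    filter_upwards [hη0] with x hx
    rw [norm_mul, Real.norm_of_nonneg (Real.exp_pos _).le, mul_comm]
    exact mul_le_mul_of_nonneg_right (hC _ (hmem x hx)) (Real.exp_pos _).le
  rw [Metric.tendsto_nhds]
  intro ε hε
  obtain ⟨p, hp⟩ := exists_polynomial_near_of_continuousOn 0 1 g hg.continuousOn (ε / 3)
    (by positivity)
  obtain ⟨hpint, hplim⟩ := tendsto_tsum_polynomial hs hrv hη p
  have hclose : |∫ x, Real.exp (-x) * p.eval (Real.exp (-x)) ∂η -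
      ∫ x, Real.exp (-x) * g (Real.exp (-x)) ∂η| ≤ ε / 3 := by
    rw [← integral_sub hpint hgint]
    have := norm_integral_le_of_norm_le (hη1.1.const_mul (ε / 3)) (f := fun x =>
      Real.exp (-x) * p.eval (Real.exp (-x)) - Real.exp (-x) * g (Real.exp (-x))) (by
        filter_upwards [hη0] with x hx
        rw [← mul_sub, norm_mul, Real.norm_of_nonneg (Real.exp_pos _).le, mul_comm]
        exact mul_le_mul_of_nonneg_right (hp _ (hmem x hx)).le (Real.exp_pos _).le)
    rwa [integral_const_mul, hη1.2, mul_one] at this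
  filter_upwards [(Metric.tendsto_nhds.1 hplim) (ε / 3) (by positivity), hrv.1,
    eventually_gt_atTop 0] with t ht hLpos htpos
  obtain ⟨C', hC'⟩ := isCompact_Icc.exists_bound_of_continuousOn (s := Set.Icc (0 : ℝ) 1)
    p.continuous.continuousOn
  have hsg := summable_mul_exp_mul hq0 htpos (hs t htpos) hC
  have hsp := summable_mul_exp_mul hq0 htpos (hs t htpos) hC'
  have hdist : |(∑' k : ℕ, q k * (Real.exp (-(k / t)) * g (Real.exp (-(k / t))))) / laplace q t -
      (∑' k : ℕ, q k * (Real.exp (-(k / t)) * p.eval (Real.exp (-(k / t))))) / laplace q t| ≤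
      ε / 3 := by
    rw [← sub_div, ← hsg.tsum_sub hsp, abs_div, abs_of_pos hLpos, div_le_iff₀ hLpos, laplace,
      ← tsum_mul_left, ← Real.norm_eq_abs]
    refine tsum_of_norm_bounded ((hs t htpos).mul_left (ε / 3)).hasSum fun k => ?_
    have h0 : 0 ≤ q k * Real.exp (-(k / t)) := mul_nonneg (hq0 k) (Real.exp_pos _).le
    rw [← mul_sub, ← mul_sub, ← mul_assoc, norm_mul, Real.norm_of_nonneg h0, mul_comm,
      Real.norm_eq_abs, abs_sub_comm]
    exact mul_le_mul_of_nonneg_right (hp _ (hmem _ (by positivity))).le h0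
  rw [Real.dist_eq] at ht ⊢
  rw [abs_lt] at ht ⊢
  rw [abs_le] at hdist hclose
  constructor <;> linarith

/-- The Tauberian half of Karamata's theorem. -/
theorem RegularlyVarying.tendsto_sum_div_laplace (hrv : RegularlyVarying (laplace q) ρ)
    (hρ : 0 ≤ ρ) (hq0 : ∀ n, 0 ≤ q n)
    (hs : ∀ t > 0, Summable fun k : ℕ => q k * Real.exp (-(k / t))) :
    Tendsto (fun t : ℝ => (∑ k ∈ Finset.range (⌊t⌋₊ + 1), q k) / laplace q t) atTop
      (𝓝 (1 / Real.Gamma (1 + ρ))) := by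
  obtain ⟨η, hη0, hη, hηb⟩ := exists_measure_laplace hρ
  have hΓ : 0 < Real.Gamma (1 + ρ) := Real.Gamma_pos_of_pos (by linarith)
  have hreal : ∀ b > 0, η.real (Set.Iic b) = b ^ ρ / Real.Gamma (1 + ρ) := fun b hb => by
    rw [Measure.real, hηb b hb, ENNReal.toReal_ofReal (by positivity)]
  have hfin : ∀ b > 0, η (Set.Iic b) ≠ ∞ := fun b hb => by rw [hηb b hb]; simp
  have hindint : ∀ b > 0, Integrable ((Set.Iic b).indicator (1 : ℝ → ℝ)) η := fun b hb =>
    (integrable_indicator_iff measurableSet_Iic).2 (integrableOn_const (hfin b hb))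
  -- The partial sum up to `t` tests the rescaled sequence against the indicator of x ≤ 1. Ramps
  -- from `a < 1` to 1 and from 1 to `b > 1` sandwich it, and continuity of b^ρ at 1 closes the gap.
  have hramp : ∀ a b : ℝ, 0 < a → a < b → ∀ g : ℝ → ℝ, Continuous g →
      (∀ x, 0 ≤ Real.exp (-x) * g (Real.exp (-x)) ∧ Real.exp (-x) * g (Real.exp (-x)) ≤ 1 ∧
        (x ≤ a → Real.exp (-x) * g (Real.exp (-x)) = 1) ∧
        (b ≤ x → Real.exp (-x) * g (Real.exp (-x)) = 0)) →
      a ^ ρ / Real.Gamma (1 + ρ) ≤ ∫ x, Real.exp (-x) * g (Real.exp (-x)) ∂η ∧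
      ∫ x, Real.exp (-x) * g (Real.exp (-x)) ∂η ≤ b ^ ρ / Real.Gamma (1 + ρ) := by
    intro a b ha hab g hg hgx
    have hb := ha.trans hab
    have hle : ∀ x, Real.exp (-x) * g (Real.exp (-x)) ≤ (Set.Iic b).indicator 1 x := fun x => by
      by_cases hx : x ≤ b
      · simpa [hx] using (hgx x).2.1
      · simp [hx, (hgx x).2.2.2 (not_le.1 hx).le]
    have hge : ∀ x, (Set.Iic a).indicator 1 x ≤ Real.exp (-x) * g (Real.exp (-x)) := fun x => by
      by_cases hx : x ≤ a
      · simp [hx, (hgx x).2.2.1 hx]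
      · simpa [hx] using (hgx x).1
    have hint : Integrable (fun x => Real.exp (-x) * g (Real.exp (-x))) η :=
      (hindint b hb).mono' (by fun_prop) (ae_of_all _ fun x => by
        rw [Real.norm_of_nonneg (hgx x).1]; exact hle x)
    rw [← hreal a ha, ← hreal b hb, ← integral_indicator_one measurableSet_Iic,
      ← integral_indicator_one measurableSet_Iic]
    exact ⟨integral_mono (hindint a ha) hint hge, integral_mono hint (hindint b hb) hle⟩
  have hsum : ∀ t > 0, ∑ k ∈ Finset.range (⌊t⌋₊ + 1), q k =
      ∑' k : ℕ, q k * (Set.Iic (1 : ℝ)).indicator 1 (k / t) := fun t ht => by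
    have hmem : ∀ k : ℕ, k ∈ Finset.range (⌊t⌋₊ + 1) ↔ (k / t : ℝ) ∈ Set.Iic (1 : ℝ) := fun k => by
      rw [Set.mem_Iic, Finset.mem_range, Nat.lt_succ_iff, Nat.le_floor_iff ht.le,
        div_le_one ht]
    rw [tsum_eq_sum (s := Finset.range (⌊t⌋₊ + 1)) fun k hk => by
      rw [Set.indicator_of_notMem fun h => hk ((hmem k).2 h), mul_zero]]
    refine Finset.sum_congr rfl fun k hk => ?_
    rw [Set.indicator_of_mem ((hmem k).1 hk)]
    simp
  have hsind : ∀ t > 0, Summable fun k : ℕ => q k * (Set.Iic (1 : ℝ)).indicator 1 (k / t) := by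
    intro t ht
    refine summable_of_hasFiniteSupport ((Set.finite_Iic ⌊t⌋₊).subset fun k hk => ?_)
    by_contra hcon
    refine hk ?_
    have : ¬ (k / t : ℝ) ≤ 1 := fun h => hcon (Nat.le_floor ((div_le_one ht).1 h))
    simp [this]
  have hcont : Continuous fun b : ℝ => b ^ ρ / Real.Gamma (1 + ρ) :=
    (Real.continuous_rpow_const hρ).div_const _
  have hbd : ∀ g : ℝ → ℝ, Continuous g → ∃ C, ∀ y ∈ Set.Icc (0 : ℝ) 1, |g y| ≤ C := fun g hg =>
    isCompact_Icc.exists_bound_of_continuousOn hg.continuousOn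
  rw [tendsto_order]
  constructor
  · intro l hl
    obtain ⟨a, ha0, ha1, hla⟩ : ∃ a : ℝ, 0 < a ∧ a < 1 ∧ l < a ^ ρ / Real.Gamma (1 + ρ) := by
      have h1 : ∀ᶠ b in 𝓝[<] (1 : ℝ), l < b ^ ρ / Real.Gamma (1 + ρ) :=
        (hcont.tendsto 1).mono_left nhdsWithin_le_nhds |>.eventually (lt_mem_nhds (by simpa using hl))
      obtain ⟨a, h1, h2, h3⟩ := (h1.and ((Ioo_mem_nhdsLT (zero_lt_one' ℝ)))).exists
      exact ⟨a, h2, h3, h1⟩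
    obtain ⟨g, hg, hgx⟩ := exists_continuous_ramp ha1
    have hlim := tendsto_tsum_continuous hq0 hs hrv hη0 hη hg
    filter_upwards [hlim.eventually (lt_mem_nhds (hla.trans_le (hramp a 1 ha0 ha1 g hg hgx).1)),
      hrv.1, eventually_gt_atTop 0] with t ht hL htpos
    refine ht.trans_le (div_le_div_of_nonneg_right ?_ hL.le)
    obtain ⟨C, hC⟩ := hbd g hg
    rw [hsum t htpos]
    refine (summable_mul_exp_mul hq0 htpos (hs t htpos) hC).tsum_le_tsum (fun k => ?_)
      (hsind t htpos)
    refine mul_le_mul_of_nonneg_left ?_ (hq0 k)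
    by_cases hx : (k / t : ℝ) ≤ 1
    · simpa [hx] using (hgx (k / t)).2.1
    · simp [hx, (hgx (k / t)).2.2.2 (not_le.1 hx).le]
  · intro l hl
    obtain ⟨b, hb1, hlb⟩ : ∃ b : ℝ, 1 < b ∧ b ^ ρ / Real.Gamma (1 + ρ) < l := by
      have h1 : ∀ᶠ b in 𝓝[>] (1 : ℝ), b ^ ρ / Real.Gamma (1 + ρ) < l :=
        (hcont.tendsto 1).mono_left nhdsWithin_le_nhds |>.eventually (gt_mem_nhds (by simpa using hl))
      obtain ⟨b, h1, h2⟩ := (h1.and self_mem_nhdsWithin).exists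
      exact ⟨b, h2, h1⟩
    obtain ⟨g, hg, hgx⟩ := exists_continuous_ramp hb1
    have hlim := tendsto_tsum_continuous hq0 hs hrv hη0 hη hg
    filter_upwards [hlim.eventually (gt_mem_nhds
      ((hramp 1 b one_pos hb1 g hg hgx).2.trans_lt hlb)),
      hrv.1, eventually_gt_atTop 0] with t ht hL htpos
    refine lt_of_le_of_lt (div_le_div_of_nonneg_right ?_ hL.le) ht
    obtain ⟨C, hC⟩ := hbd g hg
    rw [hsum t htpos]
    refine (hsind t htpos).tsum_le_tsum (fun k => ?_)
      (summable_mul_exp_mul hq0 htpos (hs t htpos) hC)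
    refine mul_le_mul_of_nonneg_left ?_ (hq0 k)
    by_cases hx : (k / t : ℝ) ≤ 1
    · simp [hx, (hgx (k / t)).2.2.1 hx]
    · simpa [hx] using (hgx (k / t)).1

end Tauberian

/-! ### Renewal sequences with regularly varying renewal function -/

section Renewal

theorem RegularlyVarying.of_tendsto_mul_div {A Q : ℝ → ℝ} {β G : ℝ} (hA : RegularlyVarying A β)
    (hG : 0 < G) (hQ : Tendsto (fun t => Q t * A t / t) atTop (𝓝 G)) :
    RegularlyVarying Q (1 - β) := by
  have hQpos : ∀ᶠ t in atTop, 0 < Q t := by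
    filter_upwards [hQ.eventually (lt_mem_nhds hG), hA.1, eventually_gt_atTop 0] with t h1 h2 h3
    rw [div_pos_iff_of_pos_right h3] at h1
    exact (pos_iff_pos_of_mul_pos h1).2 h2
  refine ⟨hQpos, fun c hc => ?_⟩
  have hct : Tendsto (fun t : ℝ => c * t) atTop atTop := tendsto_id.const_mul_atTop hc
  have h1 := ((hQ.comp hct).div hQ hG.ne').mul
    (((hA.2 c hc).inv₀ (Real.rpow_pos_of_pos hc β).ne').const_mul c)
  have hlim : G / G * (c * (c ^ β)⁻¹) = c ^ (1 - β) := by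
    rw [div_self hG.ne', one_mul, Real.rpow_sub hc, Real.rpow_one, div_eq_mul_inv]
  rw [hlim] at h1
  refine h1.congr' ?_
  filter_upwards [hQpos, hA.1, hct.eventually hA.1, eventually_gt_atTop 0] with t h2 h3 h4 h5
  simp only [Function.comp_apply, Pi.div_apply]
  field_simp

theorem RegularlyVarying.of_tendsto_div {f g : ℝ → ℝ} {β c : ℝ} (hf : RegularlyVarying f β)
    (hc : 0 < c) (hfg : Tendsto (fun t => f t / g t) atTop (𝓝 c)) : RegularlyVarying g β := by
  have hgpos : ∀ᶠ t in atTop, 0 < g t := by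
    filter_upwards [hfg.eventually (lt_mem_nhds hc), hf.1] with t h1 h2
    exact (div_pos_iff_of_pos_left h2).1 h1
  refine ⟨hgpos, fun d hd => ?_⟩
  have hdt : Tendsto (fun t : ℝ => d * t) atTop atTop := tendsto_id.const_mul_atTop hd
  have h1 := (hf.2 d hd).mul (hfg.div (hfg.comp hdt) hc.ne')
  rw [div_self hc.ne', mul_one] at h1
  refine h1.congr' ?_
  filter_upwards [hgpos, hf.1, hdt.eventually hf.1, hdt.eventually hgpos] with t h2 h3 h4 h5
  simp only [Function.comp_apply, Pi.div_apply]
  field_simp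

theorem isEquivalent_of_tendsto_mul_div {W A M : ℕ → ℝ} {K c : ℝ} (hK : 0 < K) (hc : 0 < c)
    (hA : ∀ᶠ n in atTop, 0 < A n)
    (hW : Tendsto (fun n => W n * A n / n) atTop (𝓝 (c * K)))
    (hM : Tendsto (fun n => M n / A n) atTop (𝓝 (1 / c))) :
    W ~[atTop] fun n => K * (n / M n) := by
  have hM0 : ∀ᶠ n in atTop, 0 < M n := by
    filter_upwards [hM.eventually (lt_mem_nhds (one_div_pos.2 hc)), hA] with n h1 h2
    exact (div_pos_iff_of_pos_right h2).1 h1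
  rw [isEquivalent_iff_tendsto_one]
  · have h1 := (hW.mul hM).const_mul K⁻¹
    rw [show K⁻¹ * (c * K * (1 / c)) = 1 by field_simp] at h1
    refine h1.congr' ?_
    filter_upwards [hM0, hA, eventually_gt_atTop 0] with n h2 h3 h4
    have h4' : (0 : ℝ) < n := by exact_mod_cast h4
    simp only [Pi.div_apply]
    field_simp
  · filter_upwards [hM0, eventually_gt_atTop 0] with n h2 h4
    have h4' : (0 : ℝ) < n := by exact_mod_cast h4
    exact (mul_pos hK (div_pos h4' h2)).ne'

theorem tendsto_mul_one_sub_exp :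
    Tendsto (fun t : ℝ => t * (1 - Real.exp (-(1 / t)))) atTop (𝓝 1) := by
  have h := (hasDerivAt_iff_tendsto_slope_zero.1 (Real.hasDerivAt_exp 0))
  have hneg : Tendsto (fun t : ℝ => -(1 / t)) atTop (𝓝[≠] 0) := by
    refine tendsto_nhdsWithin_iff.2 ⟨?_, ?_⟩
    · have : Tendsto (fun t : ℝ => 1 / t) atTop (𝓝 0) := by
        simpa using tendsto_inv_atTop_zero (𝕜 := ℝ)
      simpa using this.neg
    · filter_upwards [eventually_gt_atTop 0] with t ht
      simpa using ht.ne'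
  have h2 := h.comp hneg
  simp only [zero_add, Real.exp_zero, smul_eq_mul] at h2
  refine h2.congr' ?_
  filter_upwards [eventually_gt_atTop 0] with t ht
  simp only [Function.comp_apply]
  field_simp
  ring

variable {u q : ℕ → ℝ}

/-- The renewal equation makes the Cauchy product of the two series a geometric series in e^{-1/t}.
-/
theorem laplace_mul_laplace (hu0 : ∀ n, 0 ≤ u n) (hu1 : ∀ n, u n ≤ 1) (hq0 : ∀ n, 0 ≤ q n)
    (hq1 : ∀ n, q n ≤ 1)
    (hren : ∀ n, ∑ k ∈ Finset.range (n + 1), u (n - k) * q k = 1) {t : ℝ} (ht : 0 < t) :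
    laplace u t * laplace q t = (1 - Real.exp (-(1 / t)))⁻¹ := by
  have hsu := summable_mul_exp hu0 hu1 ht
  have hsq := summable_mul_exp hq0 hq1 ht
  rw [mul_comm, laplace, laplace,
    tsum_mul_tsum_eq_tsum_sum_range_of_summable_norm hsq.norm hsu.norm,
    ← tsum_geometric_of_lt_one (Real.exp_pos _).le
      (Real.exp_lt_one_iff.2 (neg_neg_of_pos (one_div_pos.2 ht)))]
  refine tsum_congr fun n => ?_
  calc ∑ k ∈ Finset.range (n + 1), q k * Real.exp (-(k / t)) *
        (u (n - k) * Real.exp (-((n - k : ℕ) / t)))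
      = ∑ k ∈ Finset.range (n + 1), u (n - k) * q k * Real.exp (-(1 / t)) ^ n := by
        refine Finset.sum_congr rfl fun k hk => ?_
        have hkn : k ≤ n := Nat.lt_succ_iff.1 (Finset.mem_range.1 hk)
        have : Real.exp (-(1 / t)) ^ n =
            Real.exp (-(k / t)) * Real.exp (-((n - k : ℕ) / t)) := by
          rw [← Real.exp_nat_mul, ← Real.exp_add, Nat.cast_sub hkn]
          congr 1
          ring
        rw [this]
        ring
    _ = Real.exp (-(1 / t)) ^ n := by rw [← Finset.sum_mul, hren, one_mul]

/-- Asymptotics of the truncated mean of a renewal distribution whose renewal function is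
regularly varying. -/
theorem tendsto_sum_mul_div_of_renewal {β : ℝ} (hβ0 : 0 ≤ β) (hβ1 : β ≤ 1)
    (hu0 : ∀ n, 0 ≤ u n) (hu1 : ∀ n, u n ≤ 1) (hq0 : ∀ n, 0 ≤ q n) (hq1 : ∀ n, q n ≤ 1)
    (hren : ∀ n, ∑ k ∈ Finset.range (n + 1), u (n - k) * q k = 1)
    (hA : RegularlyVarying (fun t => ∑ k ∈ Finset.range (⌊t⌋₊ + 1), u k) β) :
    Tendsto (fun t : ℝ => (∑ k ∈ Finset.range (⌊t⌋₊ + 1), q k) *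
      (∑ k ∈ Finset.range (⌊t⌋₊ + 1), u k) / t) atTop
      (𝓝 (1 / (Real.Gamma (1 + β) * Real.Gamma (2 - β)))) := by
  set A : ℝ → ℝ := fun t => ∑ k ∈ Finset.range (⌊t⌋₊ + 1), u k with hAdef
  have hmono : Monotone A := fun s t hst =>
    Finset.sum_le_sum_of_subset_of_nonneg
      (Finset.range_mono (Nat.add_le_add_right (Nat.floor_mono hst) 1)) fun k _ _ => hu0 k
  have hnn : ∀ t, 0 ≤ A t := fun t => Finset.sum_nonneg fun k _ => hu0 k
  have hΓ : 0 < Real.Gamma (1 + β) := Real.Gamma_pos_of_pos (by linarith)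
  have hU : Tendsto (fun t => laplace u t / A t) atTop (𝓝 (Real.Gamma (1 + β))) := by
    refine (hA.tendsto_integral_exp hmono hnn hβ0 hβ1).congr' ?_
    filter_upwards [eventually_gt_atTop 0] with t ht
    rw [laplace, tsum_mul_exp_eq_integral hu0 hu1 ht]
  -- The product of the two transforms is asymptotic to `t`, so the asymptotics of one, `hU`,
  -- determine the other.
  have hQ : Tendsto (fun t => laplace q t * A t / t) atTop (𝓝 (1 / Real.Gamma (1 + β))) := by
    have h1 := (tendsto_mul_one_sub_exp.inv₀ one_ne_zero).mul (hU.inv₀ hΓ.ne')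
    rw [inv_one, one_mul, ← one_div] at h1
    refine h1.congr' ?_
    filter_upwards [eventually_gt_atTop 0, hA.1, hU.eventually (lt_mem_nhds hΓ)] with t ht hAt hUt
    have hUpos : 0 < laplace u t := (div_pos_iff_of_pos_right hAt).1 hUt
    have hprod := laplace_mul_laplace hu0 hu1 hq0 hq1 hren ht
    have hQeq : laplace q t = (1 - Real.exp (-(1 / t)))⁻¹ / laplace u t := by
      rw [eq_div_iff hUpos.ne', mul_comm, hprod]
    rw [hQeq, mul_inv, inv_div]
    ring
  have hrv := hA.of_tendsto_mul_div (one_div_pos.2 hΓ) hQ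
  have hS := hrv.tendsto_sum_div_laplace (by linarith) hq0 fun t ht => summable_mul_exp hq0 hq1 ht
  rw [show 1 + (1 - β) = 2 - β by ring] at hS
  have h2 := hS.mul hQ
  rw [show 1 / Real.Gamma (2 - β) * (1 / Real.Gamma (1 + β)) =
    1 / (Real.Gamma (1 + β) * Real.Gamma (2 - β)) by rw [one_div_mul_one_div, mul_comm]] at h2
  refine h2.congr' ?_
  filter_upwards [hrv.1] with t ht
  rw [hAdef]
  field_simp

/-- If `u` were summable, dominated convergence and `q → 0` would send the left side of the renewal
equation to zero, although it is always one. -/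
theorem tendsto_sum_atTop_of_renewal (hu0 : ∀ n, 0 ≤ u n) (hq0 : ∀ n, 0 ≤ q n)
    (hq1 : ∀ n, q n ≤ 1) (hren : ∀ n, ∑ k ∈ Finset.range (n + 1), u (n - k) * q k = 1)
    (hq : Tendsto q atTop (𝓝 0)) :
    Tendsto (fun n => ∑ i ∈ Finset.range (n + 1), u i) atTop atTop := by
  refine (tendsto_add_atTop_iff_nat 1).2
    ((not_summable_iff_tendsto_nat_atTop_of_nonneg hu0).1 fun hsum => ?_)
  have hlim : Tendsto (fun n => ∑' k, if k < n + 1 then u k * q (n - k) else 0) atTop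
      (𝓝 (∑' _ : ℕ, 0)) := by
    refine tendsto_tsum_of_dominated_convergence hsum (fun k => ?_)
      (Eventually.of_forall fun n k => ?_)
    · have h1 : Tendsto (fun n => u k * q (n - k)) atTop (𝓝 (u k * 0)) :=
        (hq.comp (tendsto_sub_atTop_nat k)).const_mul _
      rw [mul_zero] at h1
      refine h1.congr' ?_
      filter_upwards [eventually_ge_atTop k] with n hn
      rw [if_pos (by omega)]
    · split_ifs
      · rw [Real.norm_of_nonneg (mul_nonneg (hu0 _) (hq0 _))]
        exact mul_le_of_le_one_right (hu0 _) (hq1 _)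
      · simpa using hu0 k
  rw [tsum_zero] at hlim
  have hone : ∀ n, ∑' k, (if k < n + 1 then u k * q (n - k) else 0) = 1 := fun n => by
    rw [tsum_eq_sum (s := Finset.range (n + 1)) fun k hk => by
      rw [if_neg (by simpa using hk)], ← hren n, ← Finset.sum_range_reflect]
    refine Finset.sum_congr rfl fun k hk => ?_
    have hk' := Finset.mem_range.1 hk
    rw [if_pos (by omega), show n + 1 - 1 - k = n - k by omega, show n - (n - k) = k by omega]
  simp_rw [hone] at hlim
  exact one_ne_zero (tendsto_nhds_unique tendsto_const_nhds hlim)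

theorem sum_sum_range_mul (u v : ℕ → ℝ) (n : ℕ) :
    ∑ m ∈ Finset.range (n + 1), ∑ k ∈ Finset.range (m + 1), u (m - k) * v k =
      ∑ k ∈ Finset.range (n + 1), u (n - k) * ∑ i ∈ Finset.range (k + 1), v i := by
  induction n with
  | zero => simp
  | succ n ih =>
    rw [Finset.sum_range_succ, ih, Finset.sum_range_succ' _ (n + 1),
      Finset.sum_range_succ' _ (n + 1)]
    simp only [Finset.sum_range_succ _ (_ + 1), mul_add, Finset.sum_add_distrib,
      Nat.add_sub_add_right]
    simp
    ring

end Renewal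

/-! ### Return and entrance times -/

section Times

variable {X : Type*} {D : Set X}

theorem natCast_succ_le_returnTime (A : Set X) (ω : ℕ → X) (k : ℕ) :
    ((k + 1 : ℕ) : ℕ∞) ≤ returnTime A ω ↔ ∀ i < k, ω (i + 1) ∉ A := by
  rw [returnTime, le_sInf_iff]
  constructor
  · intro h i hi hmem
    have := h ((i + 1 : ℕ) : ℕ∞) ⟨i + 1, rfl, by omega, hmem⟩
    rw [Nat.cast_le] at this
    omega
  · rintro h _ ⟨n, rfl, hn1, hn⟩
    rw [Nat.cast_le]
    by_contra hlt
    obtain ⟨i, rfl⟩ := Nat.exists_eq_add_of_le' hn1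
    exact h i (by omega) hn

theorem entranceTime_le_iff (ω : ℕ → X) (n : ℕ) :
    entranceTime D ω ≤ (n : ℕ∞) ↔ ∃ k ≤ n, ω k ∈ D := by
  have hiter : ∀ (k : ℕ) (ω : ℕ → X) (i : ℕ), pathShift^[k] ω i = ω (i + k) := by
    intro k
    induction k with
    | zero => intro ω i; rfl
    | succ k ih =>
      intro ω i
      rw [Function.iterate_succ_apply, ih, pathShift, add_assoc]
  have hmem : ∀ k : ℕ, pathShift^[k] ω ∈ startIn D ↔ ω k ∈ D := fun k => by
    rw [startIn, Set.mem_ofPred_eq, hiter, zero_add]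
  constructor
  · intro h
    by_contra hcon
    push Not at hcon
    have : ((n + 1 : ℕ) : ℕ∞) ≤ entranceTime D ω := by
      refine le_sInf ?_
      rintro _ ⟨k, rfl, hk⟩
      rw [Nat.cast_le]
      by_contra hlt
      exact hcon k (by omega) ((hmem k).1 hk)
    have := this.trans h
    rw [Nat.cast_le] at this
    omega
  · rintro ⟨k, hk, hkD⟩
    have hle : entranceTime D ω ≤ (k : ℕ∞) := sInf_le ⟨k, rfl, (hmem k).2 hkD⟩
    exact hle.trans (by exact_mod_cast hk)

end Times

/-! ### Path probabilities through the killed chain -/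

section PathEvents

variable {X : Type*} [MeasurableSpace X] (P : Kernel X X) {a S D : Set X}

/-- The probability of a visit to `D` at the times `0, …, n`. -/
noncomputable def hitBy (P : Kernel X X) (D : Set X) (n : ℕ) (x : X) : ℝ≥0∞ :=
  1 - Dᶜ.indicator (survival P D n) x

theorem measurable_hitBy (hD : MeasurableSet D) (n : ℕ) : Measurable (hitBy P D n) :=
  measurable_const.sub ((measurable_survival hD n).indicator hD.compl)

theorem hitBy_of_mem {P : Kernel X X} {x : X} (hx : x ∈ D) (n : ℕ) : hitBy P D n x = 1 := by
  simp [hitBy, hx]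

theorem hitBy_of_notMem {P : Kernel X X} {x : X} (hx : x ∉ D) (n : ℕ) :
    hitBy P D n x = 1 - survival P D n x := by
  simp [hitBy, hx]

variable [IsMarkovKernel P]

theorem pathLaw_preimage_shift (x : X) {E : Set (ℕ → X)} (hE : MeasurableSet E) :
    pathLaw P x (pathShift ⁻¹' E) = ∫⁻ y, pathLaw P y E ∂(P x) := by
  have := lintegral_pathLaw_mul_shift P x (f := fun _ => 1) measurable_const
    (measurable_one.indicator hE)
  simp only [one_mul, lintegral_indicator_one hE] at this
  rw [← this, ← lintegral_indicator_one (measurable_pathShift hE)]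
  rfl

theorem pathLaw_start_inter (x : X) {A : Set X} (hA : MeasurableSet A) {E : Set (ℕ → X)}
    (hE : MeasurableSet E) :
    pathLaw P x ({ω | ω 0 ∈ A} ∩ E) = A.indicator (fun _ => pathLaw P x E) x := by
  have hmA : MeasurableSet {ω : ℕ → X | ω 0 ∈ A} := measurable_pi_apply 0 hA
  have hpre : pathCons x ⁻¹' {ω | ω 0 ∈ A} = {_ω | x ∈ A} := rfl
  rw [pathLaw_eq_map_cons, Measure.map_apply (measurable_pathCons x) (hmA.inter hE),
    Measure.map_apply (measurable_pathCons x) hE, Set.preimage_inter, hpre]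
  by_cases hx : x ∈ A <;> simp [hx]

/-- The bridge from path space to the killed operator: prefixing an event with one step that lands
outside `a` amounts to one application of `killedStep`. It serves both `survival` and `taboo`. -/
theorem pathLaw_eq_killed (ha : MeasurableSet a) {E : ℕ → Set (ℕ → X)}
    (hE : ∀ k, MeasurableSet (E k))
    (hrec : ∀ k, E (k + 1) = pathShift ⁻¹' ({ω | ω 0 ∈ aᶜ} ∩ E k)) (k : ℕ) (x : X) :
    pathLaw P x (E k) = killed P a k (fun y => pathLaw P y (E 0)) x := by
  induction k generalizing x with
  | zero => rfl
  | succ k ih =>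
    have hm : MeasurableSet ({ω : ℕ → X | ω 0 ∈ aᶜ} ∩ E k) :=
      (measurable_pi_apply 0 ha.compl).inter (hE k)
    rw [hrec, pathLaw_preimage_shift P x hm, killed_succ', killedStep,
      ← lintegral_indicator ha.compl]
    refine lintegral_congr fun y => ?_
    rw [pathLaw_start_inter P y ha.compl (hE k)]
    by_cases hy : y ∈ aᶜ
    · rw [Set.indicator_of_mem hy, Set.indicator_of_mem hy, ih]
    · rw [Set.indicator_of_notMem hy, Set.indicator_of_notMem hy]

theorem measurableSet_avoid (ha : MeasurableSet a) (k : ℕ) :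
    MeasurableSet {ω : ℕ → X | ∀ i < k, ω (i + 1) ∉ a} := by
  have : {ω : ℕ → X | ∀ i < k, ω (i + 1) ∉ a} = ⋂ i, ⋂ (_ : i < k), {ω | ω (i + 1) ∈ aᶜ} := by
    ext; simp
  rw [this]
  exact .iInter fun i => .iInter fun _ => measurable_pi_apply (i + 1) ha.compl

theorem pathLaw_avoid (ha : MeasurableSet a) (k : ℕ) (x : X) :
    pathLaw P x {ω | ∀ i < k, ω (i + 1) ∉ a} = survival P a k x := by
  rw [pathLaw_eq_killed P ha (E := fun k => {ω | ∀ i < k, ω (i + 1) ∉ a})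
    (fun k => measurableSet_avoid ha k) (fun k => by
      ext ω
      simp only [Set.mem_ofPred_eq, Set.preimage_inter, Set.mem_inter_iff, Set.mem_preimage,
        pathShift, Set.mem_compl_iff]
      exact Nat.forall_lt_succ_left) k x]
  simp [survival, Pi.one_def]

theorem pathLaw_avoid_inter (ha : MeasurableSet a) (hS : MeasurableSet S) (k : ℕ) (x : X) :
    pathLaw P x {ω | (∀ i < k, ω (i + 1) ∉ a) ∧ ω (k + 1) ∈ S} = taboo P a S k x := by
  rw [pathLaw_eq_killed P ha (E := fun k => {ω | (∀ i < k, ω (i + 1) ∉ a) ∧ ω (k + 1) ∈ S})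
    (fun k => (measurableSet_avoid ha k).inter (measurable_pi_apply (k + 1) hS)) (fun k => by
      ext ω
      simp only [Set.mem_ofPred_eq, Set.preimage_inter, Set.mem_inter_iff, Set.mem_preimage,
        pathShift, Set.mem_compl_iff]
      rw [Nat.forall_lt_succ_left, and_assoc]) k x, taboo]
  congr 1
  ext y
  have : {ω : ℕ → X | (∀ i < 0, ω (i + 1) ∉ a) ∧ ω (0 + 1) ∈ S} =
      pathShift ⁻¹' ({ω | ω 0 ∈ S} ∩ Set.univ) := by
    ext; simp [pathShift]
  have hm : MeasurableSet ({ω : ℕ → X | ω 0 ∈ S} ∩ Set.univ) :=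
    (measurable_pi_apply 0 hS).inter .univ
  rw [this, pathLaw_preimage_shift P y hm]
  simp_rw [pathLaw_start_inter P _ hS .univ, measure_univ]
  exact lintegral_indicator_one hS

theorem lintegral_visitsUntil (ha : MeasurableSet a) (hS : MeasurableSet S) (x : X) :
    ∫⁻ ω, visitsUntil S a ω ∂(pathLaw P x) = ∑' k, taboo P a S k x := by
  have hset : ∀ k : ℕ, {ω : ℕ → X | 1 ≤ k + 1 ∧ ((k + 1 : ℕ) : ℕ∞) ≤ returnTime a ω ∧
      ω (k + 1) ∈ S} = {ω | (∀ i < k, ω (i + 1) ∉ a) ∧ ω (k + 1) ∈ S} := fun k => by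
    ext ω
    simp only [Set.mem_ofPred_eq, natCast_succ_le_returnTime]
    simp
  have hm : ∀ k : ℕ, MeasurableSet {ω : ℕ → X | (∀ i < k, ω (i + 1) ∉ a) ∧ ω (k + 1) ∈ S} :=
    fun k => (measurableSet_avoid ha k).inter (measurable_pi_apply (k + 1) hS)
  have hvis : ∀ ω, visitsUntil S a ω =
      ∑' k, {ω : ℕ → X | (∀ i < k, ω (i + 1) ∉ a) ∧ ω (k + 1) ∈ S}.indicator 1 ω := fun ω => by
    rw [visitsUntil, tsum_eq_zero_add' ENNReal.summable]
    simp_rw [hset]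
    simp
  simp_rw [hvis]
  rw [lintegral_tsum fun k => (measurable_one.indicator (hm k)).aemeasurable]
  refine tsum_congr fun k => ?_
  rw [lintegral_indicator_one (hm k), pathLaw_avoid_inter P ha hS]

theorem alwaysHits_of_frequently (ha : MeasurableSet a)
    (h : ∀ x, ∀ᵐ ω ∂(pathLaw P x), ∃ᶠ n in atTop, ω n ∈ a) : AlwaysHits P a := by
  intro x
  simp_rw [← pathLaw_avoid P ha]
  have hanti : Antitone fun k => {ω : ℕ → X | ∀ i < k, ω (i + 1) ∉ a} :=
    fun k l hkl ω hω i hi => hω i (hi.trans_le hkl)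
  have := tendsto_measure_iInter_atTop (μ := pathLaw P x)
    (fun k => (measurableSet_avoid ha k).nullMeasurableSet) hanti ⟨0, measure_ne_top _ _⟩
  have hnull : pathLaw P x (⋂ k, {ω : ℕ → X | ∀ i < k, ω (i + 1) ∉ a}) = 0 := by
    refine measure_mono_null ?_ (h x)
    intro ω hω hfreq
    rw [Set.mem_iInter] at hω
    obtain ⟨n, hn1, hn⟩ := (frequently_atTop.1 hfreq) 1
    obtain ⟨i, rfl⟩ := Nat.exists_eq_add_of_le' hn1
    exact hω (i + 1) i (by omega) hn
  rwa [hnull] at this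

theorem wanderingRate_eq_lintegral (π : Measure X) (hD : MeasurableSet D) (n : ℕ) :
    wanderingRate P π D n = ∫⁻ x, hitBy P D n x ∂π := by
  have hset : {ω : ℕ → X | entranceTime D ω ≤ (n : ℕ∞)} =
      ({ω | ω 0 ∈ Dᶜ} ∩ {ω | ∀ i < n, ω (i + 1) ∉ D})ᶜ := by
    ext ω
    simp only [Set.mem_ofPred_eq, entranceTime_le_iff, Set.mem_compl_iff, Set.mem_inter_iff]
    rw [← Nat.forall_lt_succ_left (p := fun k => ω k ∉ D)]
    simp
  have hm : MeasurableSet ({ω : ℕ → X | ω 0 ∈ Dᶜ} ∩ {ω | ∀ i < n, ω (i + 1) ∉ D}) :=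
    (measurable_pi_apply 0 hD.compl).inter (measurableSet_avoid hD n)
  rw [wanderingRate, pathMeasure, hset, Measure.bind_apply hm.compl
    (measurable_pathLaw P).aemeasurable]
  refine lintegral_congr fun x => ?_
  rw [prob_compl_eq_one_sub hm, pathLaw_start_inter P x hD.compl (measurableSet_avoid hD n), hitBy]
  congr 1
  by_cases hx : x ∈ Dᶜ
  · rw [Set.indicator_of_mem hx, Set.indicator_of_mem hx, pathLaw_avoid P hD]
  · rw [Set.indicator_of_notMem hx, Set.indicator_of_notMem hx]

variable {P}

theorem hitBy_mono (x : X) : Monotone fun n => hitBy P D n x := fun _ _ hmn =>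
  tsub_le_tsub_left (Set.indicator_le_indicator (survival_antitone x hmn)) 1

theorem lintegral_hitBy_step (hD : MeasurableSet D) (n : ℕ) (x : X) :
    ∫⁻ y, hitBy P D n y ∂(P x) = 1 - survival P D (n + 1) x := by
  refine ENNReal.eq_sub_of_add_eq (ne_top_of_le_ne_top (by simp) (survival_le_one _ x)) ?_
  rw [survival, killed_succ', ← survival, killedStep, ← lintegral_indicator hD.compl,
    ← lintegral_add_left (measurable_hitBy P hD n)]
  have : ∀ y, hitBy P D n y + Dᶜ.indicator (survival P D n) y = 1 := fun y =>
    tsub_add_cancel_of_le (Set.indicator_le' (fun _ _ => survival_le_one n _)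
      (fun _ _ => zero_le) y)
  simp [this]

theorem hitBy_succ_of_notMem (hD : MeasurableSet D) {x : X} (hx : x ∉ D) (n : ℕ) :
    hitBy P D (n + 1) x = ∫⁻ y, hitBy P D n y ∂(P x) := by
  rw [hitBy_of_notMem hx, lintegral_hitBy_step hD]

/-- If `a ⊆ D` is reached from all of `D` within time `m` with probability at least `δ`, then the
entrance times to `a` and `D` are comparable. -/
theorem mul_hitBy_le (ha : MeasurableSet a) (hD : MeasurableSet D) (haD : a ⊆ D) {m : ℕ}
    {δ : ℝ≥0∞} (hδ : ∀ x ∈ D, δ ≤ hitBy P a m x) (n : ℕ) (x : X) :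
    δ * hitBy P D n x ≤ hitBy P a (n + m) x := by
  induction n generalizing x with
  | zero =>
    by_cases hx : x ∈ D
    · rw [hitBy_of_mem hx, mul_one, zero_add]; exact hδ x hx
    · rw [hitBy_of_notMem hx]; simp [survival, killed_zero]
  | succ n ih =>
    by_cases hx : x ∈ D
    · rw [hitBy_of_mem hx, mul_one]
      exact (hδ x hx).trans (hitBy_mono x (by omega))
    · rw [hitBy_succ_of_notMem hD hx, Nat.add_right_comm,
        hitBy_succ_of_notMem ha (fun h => hx (haD h)),
        ← lintegral_const_mul _ (measurable_hitBy P hD n)]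
      exact lintegral_mono ih

/-- Starting in `D` gives the term `k = 0`. A first entrance at time `k + 1` from outside `D` has,
by invariance, the mass ∫ `taboo P D D (k + 1)` dπ, and the duality `lintegral_taboo_self` turns it
into a survival integral over `D`. -/
theorem lintegral_hitBy {π : Measure X} (hinv : P.Invariant π) (hD : MeasurableSet D)
    (hπD : π D ≠ ∞) (n : ℕ) :
    ∫⁻ x, hitBy P D n x ∂π =
      ∑ k ∈ Finset.range (n + 1), ∫⁻ x in D, survival P D k x ∂π := by
  have h1 : ∀ x, hitBy P D n x =
      D.indicator 1 x + Dᶜ.indicator (fun x => ∑ j ∈ Finset.range n, taboo P D D j x) x := by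
    intro x
    by_cases hx : x ∈ D
    · simp [hitBy_of_mem hx, hx]
    · rw [hitBy_of_notMem hx, Set.indicator_of_notMem hx, Set.indicator_of_mem (by exact hx),
        zero_add, ← survival_add_sum_taboo (P := P) hD n x]
      exact ENNReal.add_sub_cancel_left (ne_top_of_le_ne_top (by simp) (survival_le_one n x))
  simp_rw [h1]
  rw [lintegral_add_left (measurable_one.indicator hD), lintegral_indicator_one hD,
    lintegral_indicator hD.compl, lintegral_finsetSum _ fun j _ => measurable_taboo hD hD j,
    Finset.sum_range_succ', add_comm]
  congr 1
  · refine Finset.sum_congr rfl fun k _ => ?_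
    rw [← lintegral_taboo_self hinv hD hπD, ← lintegral_killedStep hinv hD
      (measurable_taboo hD hD k)]
    simp only [taboo, killed_succ']
  · simp [survival, killed_zero]

end PathEvents

/-! ### Ratio limits for the mean number of visits -/

section MeanVisits

theorem toReal_le_one {r : ℝ≥0∞} (h : r ≤ 1) : r.toReal ≤ 1 := by
  simpa using ENNReal.toReal_mono ENNReal.one_ne_top h

theorem ne_top_of_le_one {r : ℝ≥0∞} (h : r ≤ 1) : r ≠ ∞ := ne_top_of_le_ne_top (by simp) h

theorem sum_Icc_one_eq_sum_range (e : ℕ → ℝ) (n : ℕ) :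
    ∑ k ∈ Finset.Icc 1 n, e k = ∑ k ∈ Finset.range n, e (k + 1) := by
  induction n with
  | zero => simp
  | succ n ih => rw [Finset.sum_Icc_succ_top (by omega), ih, Finset.sum_range_succ]

variable {X : Type*} [MeasurableSpace X] {P : Kernel X X} [IsMarkovKernel P] {π : Measure X}
  {a S D : Set X}

theorem IsAtom.renewal_real (hat : IsAtom P a) (ha : MeasurableSet a) {z : X} (hz : z ∈ a)
    (n : ℕ) : ∑ k ∈ Finset.range (n + 1), ((P ^ (n - k)) z a).toReal *
      (survival P a k z).toReal = 1 := by
  have := congrArg ENNReal.toReal (hat.sum_pow_mul_survival ha hz n)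
  rw [ENNReal.toReal_sum fun k _ => ENNReal.mul_ne_top (measure_ne_top _ _)
    (ne_top_of_le_one (survival_le_one k z))] at this
  simpa [ENNReal.toReal_mul] using this

theorem IsAtom.tendsto_sum_pow_atTop (hat : IsAtom P a) (ha : MeasurableSet a)
    (hhit : AlwaysHits P a) {z : X} (hz : z ∈ a) :
    Tendsto (fun n => ∑ i ∈ Finset.range (n + 1), ((P ^ i) z a).toReal) atTop atTop :=
  tendsto_sum_atTop_of_renewal (fun _ => ENNReal.toReal_nonneg) (fun _ => ENNReal.toReal_nonneg)
    (fun k => toReal_le_one (survival_le_one k z)) (hat.renewal_real ha hz)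
    (by simpa [Function.comp_def] using
      (ENNReal.tendsto_toReal ENNReal.zero_ne_top).comp (hhit z))

/-- By last exit, visits to `S` are the visits to `a` convolved with the occupation of `S` during
one excursion. Its total is π(S)/π(a) by Kac's formula, so `tendsto_sum_mul_div` applies. -/
theorem IsAtom.tendsto_sum_pow_div (hat : IsAtom P a) (hinv : P.Invariant π)
    (hπa : PosFinite π a) (hhit : AlwaysHits P a) (hπS : PosFinite π S) {z : X} (hz : z ∈ a) :
    Tendsto (fun n => (∑ m ∈ Finset.range (n + 1), ((P ^ (m + 1)) z S).toReal) /
      ∑ i ∈ Finset.range (n + 1), ((P ^ i) z a).toReal) atTop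
      (𝓝 ((π S).toReal / (π a).toReal)) := by
  have hπa0 : 0 < (π a).toReal := ENNReal.toReal_pos hπa.2.1.ne' hπa.2.2.ne
  have hV : Tendsto (fun n => ∑ k ∈ Finset.range (n + 1), (taboo P a S k z).toReal) atTop
      (𝓝 ((π S).toReal / (π a).toReal)) := by
    have h1 := (ENNReal.tendsto_toReal hπS.2.2.ne).comp ((tendsto_add_atTop_iff_nat 1).2
      (hat.tendsto_sum_taboo_mul hinv hπa.1 hπa.2.2.ne hhit hπS.1 hπS.2.2.ne hz))
    refine (h1.div_const (π a).toReal).congr fun n => ?_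
    rw [Function.comp_apply, ← Finset.sum_mul, ENNReal.toReal_mul,
      ENNReal.toReal_sum fun k _ => ne_top_of_le_one (taboo_le_one k z),
      mul_div_cancel_right₀ _ hπa0.ne']
  refine (tendsto_sum_mul_div (fun _ => ENNReal.toReal_nonneg)
    (fun n => toReal_le_one prob_le_one) (hat.tendsto_sum_pow_atTop hπa.1 hhit hz) hV).congr
    fun n => ?_
  rw [← sum_sum_range_mul (fun i => ((P ^ i) z a).toReal) fun k => (taboo P a S k z).toReal]
  congr 1
  refine Finset.sum_congr rfl fun m _ => ?_
  rw [hat.pow_succ_eq_sum hπa.1 hπS.1 hz m, ENNReal.toReal_sum fun k _ => ENNReal.mul_ne_top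
    (measure_ne_top _ _) (ne_top_of_le_one (taboo_le_one k z))]
  simp [ENNReal.toReal_mul]

theorem IsAtom.lintegral_pow_real (hat : IsAtom P a) (ha : MeasurableSet a)
    (hS : MeasurableSet S) {z : X} (hz : z ∈ a) (ν : Measure X) [IsProbabilityMeasure ν] (n : ℕ) :
    (∫⁻ x, (P ^ (n + 1)) x S ∂ν).toReal = (∫⁻ x, taboo P a S n x ∂ν).toReal +
      ∑ j ∈ Finset.range n, ((P ^ (n - j)) z S).toReal * (∫⁻ x, taboo P a a j x ∂ν).toReal := by
  have hle : ∀ (A : Set X) (k : ℕ), ∫⁻ x, taboo P a A k x ∂ν ≤ 1 := fun A k =>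
    (lintegral_mono fun x => taboo_le_one k x).trans_eq (by simp)
  simp_rw [hat.pow_succ_eq_taboo_add ha hS hz n]
  rw [lintegral_add_left (measurable_taboo ha hS n), lintegral_finsetSum _ fun j _ =>
    (measurable_taboo ha ha j).mul_const _]
  simp_rw [lintegral_mul_const _ (measurable_taboo ha ha _)]
  have hne : ∀ j, (∫⁻ x, taboo P a a j x ∂ν) * (P ^ (n - j)) z S ≠ ∞ := fun j =>
    ENNReal.mul_ne_top (ne_top_of_le_one (hle a j)) (measure_ne_top _ _)
  rw [ENNReal.toReal_add (ne_top_of_le_one (hle S n)) (ENNReal.sum_ne_top.2 fun j _ => hne j),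
    ENNReal.toReal_sum fun j _ => hne j]
  simp only [ENNReal.toReal_mul, mul_comm]

theorem tendsto_sum_lintegral_taboo (ha : MeasurableSet a) (hhit : AlwaysHits P a) (ν : Measure X)
    [IsProbabilityMeasure ν] :
    Tendsto (fun n => ∑ k ∈ Finset.range (n + 1), (∫⁻ x, taboo P a a k x ∂ν).toReal) atTop
      (𝓝 1) := by
  have hle : ∀ k : ℕ, ∫⁻ x, taboo P a a k x ∂ν ≤ 1 := fun k =>
    (lintegral_mono fun x => taboo_le_one k x).trans_eq (by simp)
  have hle' : ∀ k : ℕ, ∫⁻ x, survival P a k x ∂ν ≤ 1 := fun k =>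
    (lintegral_mono fun x => survival_le_one k x).trans_eq (by simp)
  have h0 : Tendsto (fun k => ∫⁻ x, survival P a k x ∂ν) atTop (𝓝 0) := by
    have := tendsto_lintegral_of_dominated_convergence (μ := ν) (f := fun _ => 0)
      (F := fun k => survival P a k) (fun _ => 1)
      (fun k => measurable_survival ha k) (fun k => ae_of_all _ fun x => survival_le_one k x)
      (by simp) (ae_of_all _ fun x => hhit x)
    simpa using this
  have h1 : Tendsto (fun k => 1 - (∫⁻ x, survival P a (k + 1) x ∂ν).toReal) atTop
      (𝓝 (1 - (0 : ℝ≥0∞).toReal)) :=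
    ((ENNReal.tendsto_toReal ENNReal.zero_ne_top).comp
      ((tendsto_add_atTop_iff_nat 1).2 h0)).const_sub 1
  rw [ENNReal.toReal_zero, sub_zero] at h1
  refine h1.congr fun n => ?_
  have hsum : ∫⁻ x, survival P a (n + 1) x ∂ν +
      ∑ k ∈ Finset.range (n + 1), ∫⁻ x, taboo P a a k x ∂ν = 1 := by
    rw [← lintegral_finsetSum _ fun j _ => measurable_taboo ha ha j,
      ← lintegral_add_left (measurable_survival ha _)]
    simp [survival_add_sum_taboo ha]
  have := congrArg ENNReal.toReal hsum
  rw [ENNReal.toReal_add (ne_top_of_le_one (hle' _))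
    (ENNReal.sum_ne_top.2 fun j _ => ne_top_of_le_one (hle j)),
    ENNReal.toReal_sum fun j _ => ne_top_of_le_one (hle j), ENNReal.toReal_one] at this
  linarith

/-- The mean number of visits to a special set is asymptotically proportional to the renewal
function of an atom, for every initial distribution. -/
theorem IsAtom.tendsto_meanVisits_div (hat : IsAtom P a) (hinv : P.Invariant π)
    (hπa : PosFinite π a) (hhit : AlwaysHits P a) (hS : IsSpecial P π S) {z : X} (hz : z ∈ a)
    (ν : Measure X) [IsProbabilityMeasure ν] :
    Tendsto (fun n : ℕ => meanVisits P π ν S n /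
      ∑ i ∈ Finset.range (n + 1), ((P ^ i) z a).toReal) atTop (𝓝 (1 / (π a).toReal)) := by
  obtain ⟨hπS, hspec⟩ := hS
  obtain ⟨C, hC⟩ := hspec a hπa.1 hπa.2.1
  have hπa0 : 0 < (π a).toReal := ENNReal.toReal_pos hπa.2.1.ne' hπa.2.2.ne
  have hπS0 : 0 < (π S).toReal := ENNReal.toReal_pos hπS.2.1.ne' hπS.2.2.ne
  set u : ℕ → ℝ := fun i => ((P ^ i) z a).toReal with hu
  set p : ℕ → ℝ := fun m => ((P ^ (m + 1)) z S).toReal with hp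
  set f : ℕ → ℝ := fun k => (∫⁻ x, taboo P a a k x ∂ν).toReal with hf
  set b : ℕ → ℝ := fun k => (∫⁻ x, taboo P a S k x ∂ν).toReal with hb
  set e : ℕ → ℝ := fun k => (∫⁻ x, (P ^ k) x S ∂ν).toReal with he
  have hA := hat.tendsto_sum_pow_atTop hπa.1 hhit hz
  have hpA := hat.tendsto_sum_pow_div hinv hπa hhit hπS hz
  change Tendsto (fun n => (∑ m ∈ Finset.range (n + 1), p m) /
    ∑ i ∈ Finset.range (n + 1), u i) atTop _ at hpA
  change Tendsto (fun n => ∑ i ∈ Finset.range (n + 1), u i) atTop atTop at hA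
  have hpTop : Tendsto (fun n => ∑ m ∈ Finset.range (n + 1), p m) atTop atTop := by
    have := hpA.pos_mul_atTop (div_pos hπS0 hπa0) hA
    refine this.congr' ?_
    filter_upwards [hA.eventually_gt_atTop 0] with n hn
    exact div_mul_cancel₀ _ hn.ne'
  have hconv := tendsto_sum_mul_div (u := p) (fun _ => ENNReal.toReal_nonneg)
    (fun n => toReal_le_one prob_le_one) hpTop (tendsto_sum_lintegral_taboo hπa.1 hhit ν)
  -- Here specialness enters: visits to `S` up to the first hit of `a` are bounded in mean uniformly
  -- in the initial state, hence for every `ν`.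
  have hbC : ∀ n, ∑ k ∈ Finset.range n, b k ≤ C := by
    intro n
    have hle : ∑ k ∈ Finset.range n, ∫⁻ x, taboo P a S k x ∂ν ≤ C := by
      rw [← lintegral_finsetSum _ fun j _ => measurable_taboo hπa.1 hπS.1 j]
      calc _ ≤ ∫⁻ _, (C : ℝ≥0∞) ∂ν := lintegral_mono fun x =>
            (ENNReal.sum_le_tsum _).trans ((lintegral_visitsUntil P hπa.1 hπS.1 x).symm.le.trans
              (hC x))
        _ = C := by simp
    have hk : ∀ k : ℕ, ∫⁻ x, taboo P a S k x ∂ν ≤ 1 := fun k =>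
      (lintegral_mono fun x => taboo_le_one k x).trans_eq (by simp)
    have := ENNReal.toReal_mono ENNReal.coe_ne_top hle
    rwa [ENNReal.toReal_sum fun j _ => ne_top_of_le_one (hk j), ENNReal.coe_toReal] at this
  -- The summed first entrance decomposition. At `k = 0` the entrance sum is empty, so the
  -- convolution runs one index behind.
  have hE : ∀ n, ∑ k ∈ Finset.range (n + 2), e (k + 1) = ∑ k ∈ Finset.range (n + 2), b k +
      ∑ k ∈ Finset.range (n + 1), p (n - k) * ∑ i ∈ Finset.range (k + 1), f i := by
    intro n
    have hstep : ∀ k, e (k + 1) = b k + ∑ j ∈ Finset.range k, ((P ^ (k - j)) z S).toReal * f j :=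
      fun k => hat.lintegral_pow_real hπa.1 hπS.1 hz ν k
    simp_rw [hstep]
    rw [Finset.sum_add_distrib, ← sum_sum_range_mul]
    congr 1
    rw [Finset.sum_range_succ', Finset.range_zero, Finset.sum_empty, add_zero]
    refine Finset.sum_congr rfl fun m _ => Finset.sum_congr rfl fun j hj => ?_
    have hjm : j < m + 1 := Finset.mem_range.1 hj
    rw [hp]
    simp only
    rw [show m + 1 - j = m - j + 1 by omega]
  have hb0 : Tendsto (fun n => (∑ k ∈ Finset.range (n + 2), b k) /
      ∑ i ∈ Finset.range (n + 1), u i) atTop (𝓝 0) := by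
    refine squeeze_zero' (Eventually.of_forall fun n => div_nonneg
      (Finset.sum_nonneg fun _ _ => ENNReal.toReal_nonneg)
      (Finset.sum_nonneg fun _ _ => ENNReal.toReal_nonneg)) ?_ (hA.const_div_atTop (C : ℝ))
    exact Eventually.of_forall fun n => div_le_div_of_nonneg_right (hbC _)
      (Finset.sum_nonneg fun _ _ => ENNReal.toReal_nonneg)
  -- `hE` counts visits up to time `n + 2`, to be compared with the renewal function at `n + 2`; the
  -- two extra terms are bounded.
  have hshift : Tendsto (fun n => (∑ i ∈ Finset.range (n + 1), u i) /
      ∑ i ∈ Finset.range (n + 3), u i) atTop (𝓝 1) := by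
    have hA2 : Tendsto (fun n => ∑ i ∈ Finset.range (n + 3), u i) atTop atTop :=
      (tendsto_add_atTop_iff_nat 2).2 hA
    have h0 : Tendsto (fun n => (u (n + 1) + u (n + 2)) / ∑ i ∈ Finset.range (n + 3), u i) atTop
        (𝓝 0) := by
      refine squeeze_zero' (Eventually.of_forall fun n => div_nonneg
        (add_nonneg ENNReal.toReal_nonneg ENNReal.toReal_nonneg)
        (Finset.sum_nonneg fun _ _ => ENNReal.toReal_nonneg)) ?_ (hA2.const_div_atTop (2 : ℝ))
      refine Eventually.of_forall fun n => div_le_div_of_nonneg_right ?_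
        (Finset.sum_nonneg fun _ _ => ENNReal.toReal_nonneg)
      have h1 : u (n + 1) ≤ 1 := toReal_le_one prob_le_one
      have h2 : u (n + 2) ≤ 1 := toReal_le_one prob_le_one
      linarith
    have h1 := h0.const_sub 1
    rw [sub_zero] at h1
    refine h1.congr' ?_
    filter_upwards [hA2.eventually_gt_atTop 0] with n hn
    rw [eq_div_iff hn.ne', sub_mul, div_mul_cancel₀ _ hn.ne', Finset.sum_range_succ,
      Finset.sum_range_succ]
    ring
  have hmain : Tendsto (fun n => (∑ k ∈ Finset.range (n + 2), e (k + 1)) /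
      ∑ i ∈ Finset.range (n + 1), u i) atTop (𝓝 ((π S).toReal / (π a).toReal)) := by
    have h1 := hb0.add (hconv.mul hpA)
    rw [zero_add, one_mul] at h1
    refine h1.congr' ?_
    filter_upwards [hA.eventually_gt_atTop 0, hpTop.eventually_gt_atTop 0] with n hn hn'
    rw [hE, add_div]
    congr 1
    exact div_mul_div_cancel₀ hn'.ne'
  refine (tendsto_add_atTop_iff_nat 2).1 ?_
  have h2 := ((hmain.mul hshift).const_mul (π S).toReal⁻¹)
  rw [mul_one, show (π S).toReal⁻¹ * ((π S).toReal / (π a).toReal) = 1 / (π a).toReal by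
    field_simp] at h2
  refine h2.congr' ?_
  filter_upwards [hA.eventually_gt_atTop 0] with n hn
  rw [meanVisits, Nat.floor_natCast, div_mul_div_cancel₀ hn.ne', mul_div_assoc]
  congr 2
  exact (sum_Icc_one_eq_sum_range e (n + 2)).symm

end MeanVisits

/-! ### Wandering rates of atoms and of their finite unions -/

section WanderingRate

variable {X : Type*} [MeasurableSpace X] {P : Kernel X X} {π : Measure X} {a D : Set X}

theorem survival_congr {x y : X} (h : P x = P y) (n : ℕ) :
    survival P a n x = survival P a n y := by
  cases n with
  | zero => rfl
  | succ n => simp only [survival, killed_succ', killedStep, h]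

variable [IsMarkovKernel P]

theorem wanderingRate_ne_top (hinv : P.Invariant π) (hD : MeasurableSet D) (hπD : π D ≠ ∞)
    (n : ℕ) : wanderingRate P π D n ≠ ∞ := by
  rw [wanderingRate_eq_lintegral P π hD, lintegral_hitBy hinv hD hπD]
  refine ENNReal.sum_ne_top.2 fun k _ => ne_top_of_le_ne_top hπD ?_
  calc _ ≤ ∫⁻ x in D, 1 ∂π := lintegral_mono fun x => survival_le_one k x
    _ = π D := by simp

theorem IsAtom.wanderingRate_eq (hat : IsAtom P a) (hinv : P.Invariant π) (hπa : PosFinite π a)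
    {z : X} (hz : z ∈ a) (n : ℕ) :
    (wanderingRate P π a n).toReal =
      (π a).toReal * ∑ k ∈ Finset.range (n + 1), (survival P a k z).toReal := by
  rw [wanderingRate_eq_lintegral P π hπa.1, lintegral_hitBy hinv hπa.1 hπa.2.2.ne]
  simp_rw [setLIntegral_eq_of_forall_eq hπa.1 (fun x hx => hat.survival_eq _ hx hz)]
  rw [← Finset.sum_mul, ENNReal.toReal_mul,
    ENNReal.toReal_sum fun k _ => ne_top_of_le_one (survival_le_one k z), mul_comm]

/-- Hitting probabilities increase to one at every state, so by monotone convergence the rate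
increases to π(X) = ∞. -/
theorem tendsto_wanderingRate_atTop (hinv : P.Invariant π) (hinf : π Set.univ = ∞)
    (hD : MeasurableSet D) (hπD : π D ≠ ∞) (hhit : AlwaysHits P D) :
    Tendsto (fun n => (wanderingRate P π D n).toReal) atTop atTop := by
  have hlim : Tendsto (fun n => wanderingRate P π D n) atTop (𝓝 ∞) := by
    simp_rw [wanderingRate_eq_lintegral P π hD]
    rw [← hinf, ← lintegral_one]
    refine lintegral_tendsto_of_tendsto_of_monotone (fun n => (measurable_hitBy P hD n).aemeasurable)
      (ae_of_all _ fun x => hitBy_mono x) (ae_of_all _ fun x => ?_)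
    by_cases hx : x ∈ D
    · simp_rw [hitBy_of_mem hx]; exact tendsto_const_nhds
    · simp_rw [hitBy_of_notMem hx]
      simpa using ENNReal.Tendsto.sub (tendsto_const_nhds (x := (1 : ℝ≥0∞))) (hhit x)
        (Or.inl ENNReal.one_ne_top)
  refine tendsto_atTop.2 fun r => ?_
  filter_upwards [hlim.eventually (lt_mem_nhds (ENNReal.ofReal_lt_top (r := r)))] with n hn
  exact (ENNReal.ofReal_le_iff_le_toReal (wanderingRate_ne_top hinv hD hπD n)).1 hn.le

theorem wanderingRate_add_le (hinv : P.Invariant π) (ha : MeasurableSet a) (hπa : π a ≠ ∞)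
    (n m : ℕ) : wanderingRate P π a (n + m) ≤ wanderingRate P π a n + m * π a := by
  simp_rw [wanderingRate_eq_lintegral P π ha, lintegral_hitBy hinv ha hπa]
  rw [Nat.add_right_comm, Finset.sum_range_add]
  refine add_le_add le_rfl ((Finset.sum_le_card_nsmul _ _ (π a) fun k _ => ?_).trans_eq (by simp))
  calc _ ≤ ∫⁻ x in a, 1 ∂π := lintegral_mono fun x => survival_le_one _ x
    _ = π a := by simp

/-- The wandering rates of a finite union of atoms and of one of these atoms are equivalent. -/
theorem tendsto_wanderingRate_div {q : ℕ} {A : Fin q → Set X} (hinv : P.Invariant π)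
    (hinf : π Set.univ = ∞) (hA : ∀ i, PosFinite π (A i) ∧ IsAtom P (A i))
    (hhit : ∀ i, AlwaysHits P (A i)) (i₀ : Fin q) :
    Tendsto (fun n => (wanderingRate P π (A i₀) n).toReal /
      (wanderingRate P π (⋃ i, A i) n).toReal) atTop (𝓝 1) := by
  set D := ⋃ i, A i with hDdef
  set a := A i₀ with ha_def
  have ha : MeasurableSet a := (hA i₀).1.1
  have hπa : π a ≠ ∞ := (hA i₀).1.2.2.ne
  have hD : MeasurableSet D := .iUnion fun i => (hA i).1.1
  have hπD : π D ≠ ∞ := ne_top_of_le_ne_top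
    (ENNReal.sum_ne_top.2 fun i _ => (hA i).1.2.2.ne) (measure_iUnion_fintype_le π A)
  have haD : a ⊆ D := Set.subset_iUnion A i₀
  have hfa := wanderingRate_ne_top hinv ha hπa
  have hfD := wanderingRate_ne_top hinv hD hπD
  have hle : ∀ n, (wanderingRate P π a n).toReal ≤ (wanderingRate P π D n).toReal := fun n =>
    ENNReal.toReal_mono (hfD n) (measure_mono fun ω hω => by
      simp only [Set.mem_ofPred_eq, entranceTime_le_iff] at hω ⊢
      obtain ⟨k, hk, h⟩ := hω
      exact ⟨k, hk, haD h⟩)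
  have hDtop : Tendsto (fun n => (wanderingRate P π D n).toReal) atTop atTop :=
    tendsto_atTop_mono hle (tendsto_wanderingRate_atTop hinv hinf ha hπa (hhit i₀))
  rw [tendsto_order]
  constructor
  · intro l hl
    obtain ⟨c, hlc, hc1⟩ := exists_between (max_lt hl one_pos)
    have hc0 : 0 < c := (le_max_right _ _).trans_lt hlc
    have hl' : l < c := (le_max_left _ _).trans_lt hlc
    -- Survival probabilities are constant on each atom, and there are finitely many atoms, so
    -- convergence at one point of each is uniform on `D`.
    obtain ⟨m, hm⟩ : ∃ m, ∀ x ∈ D, ENNReal.ofReal c ≤ hitBy P a m x := by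
      have hev : ∀ i, ∀ᶠ m in atTop, ∀ x ∈ A i, survival P a m x ≤ ENNReal.ofReal (1 - c) := by
        intro i
        obtain ⟨z, hz⟩ := nonempty_of_measure_ne_zero (hA i).1.2.1.ne'
        filter_upwards [ENNReal.tendsto_nhds_zero.1 (hhit i₀ z) _
          (ENNReal.ofReal_pos.2 (sub_pos.2 hc1))] with m hm x hx
        rwa [survival_congr ((hA i).2 x hx z hz) m]
      obtain ⟨m, hm⟩ := (eventually_all.2 hev).exists
      refine ⟨m, fun x hx => ?_⟩
      obtain ⟨i, hi⟩ := Set.mem_iUnion.1 hx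
      have h1 : hitBy P a m x ≥ 1 - survival P a m x :=
        tsub_le_tsub_left (Set.indicator_le_self' (fun _ _ => zero_le) x) 1
      refine le_trans ?_ h1
      refine le_trans ?_ (tsub_le_tsub_left (hm i x hi) 1)
      rw [← ENNReal.ofReal_one, ← ENNReal.ofReal_sub _ (sub_nonneg.2 hc1.le), sub_sub_cancel]
    have hbound : ∀ n, c * (wanderingRate P π D n).toReal ≤
        (wanderingRate P π a n).toReal + m * (π a).toReal := by
      intro n
      have h1 : ENNReal.ofReal c * wanderingRate P π D n ≤ wanderingRate P π a n + m * π a := by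
        refine le_trans ?_ (wanderingRate_add_le hinv ha hπa n m)
        rw [wanderingRate_eq_lintegral P π hD, wanderingRate_eq_lintegral P π ha,
          ← lintegral_const_mul _ (measurable_hitBy P hD n)]
        exact lintegral_mono fun x => mul_hitBy_le ha hD haD hm n x
      have hmt : (m : ℝ≥0∞) * π a ≠ ∞ := ENNReal.mul_ne_top (by simp) hπa
      have := ENNReal.toReal_mono (ENNReal.add_ne_top.2 ⟨hfa n, hmt⟩) h1
      rwa [ENNReal.toReal_mul, ENNReal.toReal_ofReal hc0.le, ENNReal.toReal_add (hfa n) hmt,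
        ENNReal.toReal_mul, ENNReal.toReal_natCast] at this
    -- Beyond this threshold the gain `c - l` times the rate of `D` outweighs the cost `m * π a` of
    -- the delay.
    filter_upwards [hDtop.eventually_gt_atTop (max 0 (m * (π a).toReal / (c - l)))] with n hn
    have hn0 := (le_max_left _ _).trans_lt hn
    have hn1 := (le_max_right _ _).trans_lt hn
    rw [div_lt_iff₀ (sub_pos.2 hl')] at hn1
    rw [lt_div_iff₀ hn0]
    have := hbound n
    nlinarith
  · intro l hl
    filter_upwards [hDtop.eventually_gt_atTop 0] with n hn
    exact lt_of_le_of_lt ((div_le_one hn).2 (hle n)) hl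

/-- The renewal function of an atom of a regular chain is regularly varying. -/
theorem IsRegular.regularlyVarying_sum_pow {β : ℝ} (hreg : IsRegular P π β)
    (hinv : P.Invariant π) (hπa : PosFinite π a) (hat : IsAtom P a) (hhit : AlwaysHits P a)
    {z : X} (hz : z ∈ a) :
    RegularlyVarying (fun t => ∑ k ∈ Finset.range (⌊t⌋₊ + 1), ((P ^ k) z a).toReal) β := by
  have hπa0 : 0 < (π a).toReal := ENNReal.toReal_pos hπa.2.1.ne' hπa.2.2.ne
  obtain ⟨S, hS, hreg⟩ := hreg
  have : IsProbabilityMeasure (π[|S]) :=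
    cond_isProbabilityMeasure_of_finite hS.1.2.1.ne' hS.1.2.2.ne
  refine hreg.of_tendsto_div (one_div_pos.2 hπa0) ?_
  refine ((hat.tendsto_meanVisits_div hinv hπa hhit hS hz (π[|S])).comp
    tendsto_nat_floor_atTop).congr fun t => ?_
  simp only [Function.comp_apply, meanVisits, Nat.floor_natCast]

theorem IsAtom.tendsto_wanderingRate_mul_div {β : ℝ} (hβ0 : 0 ≤ β) (hβ1 : β ≤ 1)
    (hat : IsAtom P a) (hinv : P.Invariant π) (hπa : PosFinite π a) {z : X} (hz : z ∈ a)
    (hrv : RegularlyVarying (fun t => ∑ k ∈ Finset.range (⌊t⌋₊ + 1), ((P ^ k) z a).toReal) β)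
    (hratio : Tendsto (fun n => (wanderingRate P π a n).toReal /
      (wanderingRate P π D n).toReal) atTop (𝓝 1)) :
    Tendsto (fun n : ℕ => (wanderingRate P π D n).toReal *
      (∑ k ∈ Finset.range (n + 1), ((P ^ k) z a).toReal) / n) atTop
      (𝓝 ((π a).toReal * (1 / (Real.Gamma (1 + β) * Real.Gamma (2 - β))))) := by
  have hsum := tendsto_sum_mul_div_of_renewal hβ0 hβ1
    (u := fun k => ((P ^ k) z a).toReal) (q := fun k => (survival P a k z).toReal)
    (fun _ => ENNReal.toReal_nonneg)
    (fun n => toReal_le_one prob_le_one) (fun _ => ENNReal.toReal_nonneg)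
    (fun k => toReal_le_one (survival_le_one k z)) (hat.renewal_real hπa.1 hz) hrv
  have h1 := ((hsum.comp tendsto_natCast_atTop_atTop).const_mul (π a).toReal).mul
    (hratio.inv₀ one_ne_zero)
  rw [inv_one, mul_one] at h1
  refine h1.congr' ?_
  filter_upwards [hratio.eventually (lt_mem_nhds one_pos)] with n hn
  simp only [Function.comp_apply, Nat.floor_natCast]
  rw [mul_div_assoc, ← mul_assoc, ← hat.wanderingRate_eq hinv hπa hz n]
  have hWa : (wanderingRate P π a n).toReal ≠ 0 := fun h => by simp [h] at hn
  rw [inv_div]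
  field_simp

end WanderingRate

end HarrisChain

/-! ### The main theorem -/

open HarrisChain in
theorem lemmal {X : Type*} [MeasurableSpace X] [MeasurableSpace.CountablyGenerated X]
    (P : Kernel X X) [IsMarkovKernel P] (π : Measure X) [SigmaFinite π]
    (hHarris : HarrisChain.IsHarrisRecurrent P) (hinv : P.Invariant π) (hinf : π Set.univ = ∞)
    (β : ℝ) (hβ0 : 0 ≤ β) (hβ1 : β ≤ 1) (hreg : HarrisChain.IsRegular P π β)
    (D : Set X) (hD : HarrisChain.IsFiniteUnionOfAtoms P π D) :
    (∀ n : ℕ, HarrisChain.wanderingRate P π D n < ∞) ∧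
    HarrisChain.RegularlyVaryingSeq
      (fun n => (HarrisChain.wanderingRate P π D n).toReal) (1 - β) ∧
    ∀ (S : Set X) (ν : Measure X), HarrisChain.IsSpecial P π S → IsProbabilityMeasure ν →
      (fun n : ℕ => (HarrisChain.wanderingRate P π D n).toReal) ~[atTop]
        (fun n : ℕ => 1 / (Real.Gamma (1 + β) * Real.Gamma (2 - β)) *
          ((n : ℝ) / HarrisChain.meanVisits P π ν S n)) := by
  obtain ⟨φ, -, hφ, hφhit⟩ := hHarris
  obtain ⟨q, A, hq, hA, rfl⟩ := hD
  have hhit : ∀ i, AlwaysHits P (A i) := fun i =>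
    alwaysHits_of_pos hinv hφ (fun B hB hB0 => alwaysHits_of_frequently P hB (hφhit B hB hB0))
      (hA i).1.1 (hA i).1.2.1 (hA i).1.2.2.ne
  obtain ⟨i₀⟩ : Nonempty (Fin q) := ⟨⟨0, hq⟩⟩
  obtain ⟨hπa, hat⟩ := hA i₀
  obtain ⟨z, hz⟩ := nonempty_of_measure_ne_zero hπa.2.1.ne'
  have hπa0 : 0 < (π (A i₀)).toReal := ENNReal.toReal_pos hπa.2.1.ne' hπa.2.2.ne
  have hfin := wanderingRate_ne_top hinv (.iUnion fun i => (hA i).1.1)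
    (ne_top_of_le_ne_top (ENNReal.sum_ne_top.2 fun i _ => (hA i).1.2.2.ne)
      (measure_iUnion_fintype_le π A))
  have hKpos : 0 < 1 / (Real.Gamma (1 + β) * Real.Gamma (2 - β)) :=
    one_div_pos.2 (mul_pos (Real.Gamma_pos_of_pos (by linarith))
      (Real.Gamma_pos_of_pos (by linarith)))
  have hrv := hreg.regularlyVarying_sum_pow hinv hπa hat (hhit i₀) hz
  have hW := hat.tendsto_wanderingRate_mul_div hβ0 hβ1 hinv hπa hz hrv
    (tendsto_wanderingRate_div hinv hinf hA hhit i₀)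
  refine ⟨fun n => (hfin n).lt_top, ?_, fun S ν hS hν => ?_⟩
  -- The limit `hW` along integers passes to real arguments because ⌊t⌋/t → 1.
  · refine hrv.of_tendsto_mul_div (mul_pos hπa0 hKpos) ?_
    have h1 := (hW.comp (tendsto_nat_floor_atTop (α := ℝ))).mul
      (tendsto_nat_floor_div_atTop (R := ℝ))
    rw [mul_one] at h1
    refine h1.congr' ?_
    filter_upwards [eventually_ge_atTop 1] with t ht
    have ht' : (⌊t⌋₊ : ℝ) ≠ 0 := by exact_mod_cast (Nat.floor_pos.2 ht).ne'
    exact div_mul_div_cancel₀ ht'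
  · exact isEquivalent_of_tendsto_mul_div hKpos hπa0
      ((hat.tendsto_sum_pow_atTop hπa.1 (hhit i₀) hz).eventually_gt_atTop 0) hW
      (hat.tendsto_meanVisits_div hinv hπa (hhit i₀) hS hz ν)
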